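/- All fields have characteristic zero. A difference field $(F,\sigma)$ is a field $F$ with an automorphism $\sigma$; its constant field is $C_F=\{c\in F\mid\sigma(c)=c\}$, and $\Delta(f)=\sigma(f)-f$. A complete reduction for a $C$-subspace $U$ of a $C$-vector space $V$ is a $C$-linear map $\phi:V\to V$ with $\ker\phi=U$ and $f-\phi(f)\in U$ for all $f\in V$. A $\Sigma^*$-tower over $(F_0,\sigma)$ is a difference field extension $(F_n,\sigma)$ with $F_n=F_0(t_1,\dots,t_n)$ such that, with $F_i=F_0(t_1,\dots,t_i)$, each $t_i$ is transcendental over $F_{i-1}$, $\Delta(t_i)\in F_{i-1}$, and $C_{F_n}=C_{F_0}$. Let $(F_0,\sigma)$ be a difference field with constant field $C$, let $\phi_0:F_0\to F_0$ be a complete reduction for $\Delta(F_0)$, and let $\Theta_0$ be a $C$-basis of $F_0$. For a $\Sigma^*$-tower $F_0(t_1,\dots,t_n)$ let $\Theta_i$ be the $F_{i-1}$-basis of $F_i$ consisting of all $t_i^k$ ($k\ge0$) and all $t_i^k/q^j$ with $q\in F_{i-1}[t_i]$ monic irreducible, $0\le k<\deg q$, $j\ge1$, and let $\Xi_i=\{\theta_0\theta_1\cdots\theta_i\mid\theta_j\in\Theta_j\}$,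 a $C$-basis of $F_i$. For $\theta\in\Xi_i$ let $\theta^*:F_i\to C$ be the coefficient of $\theta$ in the expansion with respect to $\Xi_i$, and let $\operatorname{ind}(f)$ be the least $j$ with $f\in F_j$. Complete reductions $\phi_i$ for $\Delta(F_i)$, $1\le i\le n$, are constructed recursively from $\phi_0$: choose a set $S_i$ of representatives of the monic irreducible polynomials in $F_{i-1}[t_i]$ modulo the relation $p\sim c\,\sigma^{\ell}(p)$ ($c\in F_{i-1}\setminus\{0\}$, $\ell\in\mathbb Z$), and an element $\theta_i\in\Xi_{i-1}$ with $\theta_i^*(\phi_{i-1}(\Delta(t_i)))\ne0$ and $\operatorname{ind}(\theta_i)=\operatorname{ind}(\phi_{i-1}(\Delta(t_i)))$; then $\phi_i$ is the complete reduction for $\Delta(F_i)$ on $F_i$ with image $U_i\oplus V_i$, where $U_i$ is the space of fractions in $F_{i-1}(t_i)$ with numerator degree less than denominator degree that have a product of elements of $S_i$ as denominator, and $V_i=\bigoplus_{k\ge0}\bigl(\operatorname{im}(\phi_{i-1})\cap\ker(\theta_i^*)\bigr)t_i^k$. Fix the choices of $S_i$ and $\theta_i$, arbitrarily, once and for all (for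 every difference field extension of $(F_0,\sigma)$ and every tuple $(t_1,\dots,t_i)$ of generators of a tower inside it). A $\Sigma^*$-tower $F_0(t_1,\dots,t_n)$ is called well generated if $\Delta(t_i)\in\operatorname{im}(\phi_{i-1})$ for all $1\le i\le n$. **Proposition.** Let $(F_n,\sigma)$ be a $\Sigma^*$-tower over $(F_0,\sigma)$ with $F_n=F_0(t_1,\dots,t_n)$. Then there exist a well generated $\Sigma^*$-tower $(K_n,\tilde\sigma)$ over $(F_0,\sigma)$ with $K_n=F_0(u_1,\dots,u_n)$ (in particular, the complete reductions $\phi_0,\dots,\phi_n$ of this tower exist) and a field isomorphism $\tau_n:F_n\to K_n$ with $\tau_n\circ\sigma=\tilde\sigma\circ\tau_n$ and $\tau_n|_{F_0}=\operatorname{id}$. -/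

import Mathlib

open Polynomial

universe u v w

namespace SigmaTower

/-- The constant field of the difference field `(F, σ)`. -/
def constants {F : Type u} [Field F] (σ : RingAut F) : Subfield F :=
  RingHom.eqLocusField (σ : F →+* F) (RingHom.id F)

/-- A `C`-linear operator `φ : V → V` is a complete reduction for `U` if `f - φ f ∈ U` for all `f`
and `ker φ = U` (so that `U` is a subspace). -/
def IsCompleteReduction {C : Type u} {V : Type v} [Field C] [AddCommGroup V] [Module C V]
    (U : Set V) (φ : V →ₗ[C] V) : Prop :=
  (∀ f, f - φ f ∈ U) ∧ (LinearMap.ker φ : Set V) = U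

/-- The summable space `Δ(F) = {σ g - g | g ∈ F}` of a difference field `(F, σ)`. -/
def summable {F : Type u} [Field F] (σ : RingAut F) : Set F :=
  {f | ∃ g, f = σ g - g}

/-- `θ^*(f) = c`: in the expansion of `f` in the basis `B`, the basis element `θ` has the
coefficient `c`. -/
def HasCoord (C : Type u) {V : Type v} [Field C] [AddCommGroup V] [Module C V]
    (B : Set V) (θ f : V) (c : C) : Prop :=
  ∃ l ∈ Finsupp.supported C C B, Finsupp.linearCombination C id l = f ∧ l θ = c

section OneStep

/- `L` is a subfield of `K` and `t ∈ K` is transcendental over `L`; the rational function field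
`L(t)` is the subfield of `K` generated by `t` over `L`, and polynomials in `L[t]` are the elements
`aeval t p`. -/

variable {F₀ : Type u} {K : Type v} [Field F₀] [Field K] [Algebra F₀ K]

/-- The summable space `Δ(L) = {σ g - g | g ∈ L}` of a subfield `L` of `(K, σ)`. -/
def summableIn (σ : RingAut K) (L : IntermediateField F₀ K) : Set L :=
  {f | ∃ g : L, (f : K) = σ (g : K) - (g : K)}

/-- The set `M_t` of monic irreducible polynomials in `L[t]`. -/
def monicIrreducibles (L : IntermediateField F₀ K) (t : K) : Set K :=
  {x | ∃ q : L[X], q.Monic ∧ Irreducible q ∧ x = aeval t q}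

/-- `p` and `q` are `σ`-equivalent: `p = c σ^ℓ(q)` with `c ∈ L`, `c ≠ 0`, `ℓ ∈ ℤ`. -/
def SigmaEquiv (σ : RingAut K) (L : IntermediateField F₀ K) (p q : K) : Prop :=
  ∃ c : L, c ≠ 0 ∧ ∃ ℓ : ℤ, p = (c : K) * (σ ^ ℓ) q

/-- `S` is a set of representatives of the `σ`-equivalence classes on `M_t`. -/
def IsRepresentatives (σ : RingAut K) (L : IntermediateField F₀ K) (t : K) (S : Set K) : Prop :=
  S ⊆ monicIrreducibles L t ∧
    ∀ q ∈ monicIrreducibles L t, ∃! p, p ∈ S ∧ SigmaEquiv σ L p q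

/-- The set `L(t)_(r)` of `t`-proper rational functions. -/
def properFractions (L : IntermediateField F₀ K) (t : K) : Set K :=
  {f | ∃ a b : L[X], b.Monic ∧ IsCoprime a b ∧ a.degree < b.degree ∧
    f = aeval t a / aeval t b}

/-- The space `U_S` of `t`-proper fractions `a / (p₁ ^ m₁ ⋯ p_l ^ m_l)` with `p_i ∈ S`. -/
def properComplement (L : IntermediateField F₀ K) (t : K) (S : Set K) : Set K :=
  {f | f ∈ properFractions L t ∧ ∃ a : L[X], ∃ d ∈ Submonoid.closure S, f = aeval t a / d}

/-- The `θ`-complement `V_θ = ⨁ₖ (im φ ∩ ker θ^*) t ^ k`, where `θ` is an element of the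
`C`-basis `B` of `L`. -/
def polyComplement {C : Type w} [Field C] [Algebra C F₀] [Algebra C K] [IsScalarTower C F₀ K]
    (L : IntermediateField F₀ K) (t : K) (φ : L →ₗ[C] L) (B : Set K) (θ : K) : Set K :=
  {f | ∃ p : L[X], (∀ k, p.coeff k ∈ LinearMap.range φ ∧ HasCoord C B θ (p.coeff k : K) 0) ∧
    f = aeval t p}

/-- The canonical `L`-basis of `L(t)` that comes from irreducible partial fractions. -/
def canonicalStep (L : IntermediateField F₀ K) (t : K) : Set K :=
  {x | ∃ k : ℕ, x = t ^ k} ∪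
  {x | ∃ q : L[X], q.Monic ∧ Irreducible q ∧ ∃ k j : ℕ, k < q.natDegree ∧ 1 ≤ j ∧
    x = t ^ k / (aeval t q) ^ j}

end OneStep

section Tower

variable {F₀ : Type u} {K : Type v} [Field F₀] [Field K] [Algebra F₀ K]

/-- The field `F_i = F₀(t₁, …, t_i)`, where `t₁, …, t_n` are the entries of `t : Fin n → K`. -/
def stage (F₀ : Type u) {K : Type v} [Field F₀] [Field K] [Algebra F₀ K] {n : ℕ}
    (t : Fin n → K) (i : ℕ) : IntermediateField F₀ K :=
  IntermediateField.adjoin F₀ {x | ∃ j : Fin n, (j : ℕ) < i ∧ x = t j}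

/-- `(K, σ)` with `K = F₀(t₁, …, t_n)` is a `Σ*`-tower over `(F₀, σ₀)`: a difference field
extension in which each `t_i` is transcendental over `F_{i-1}` with `σ t_i - t_i ∈ F_{i-1}`, and
which has the same constants as `(F₀, σ₀)`. -/
structure IsSigmaTower (σ₀ : RingAut F₀) (σ : RingAut K) {n : ℕ} (t : Fin n → K) : Prop where
  extends_base : ∀ x : F₀, σ (algebraMap F₀ K x) = algebraMap F₀ K (σ₀ x)
  transcendental : ∀ i : Fin n, Transcendental (stage F₀ t i) (t i)
  delta_mem : ∀ i : Fin n, σ (t i) - t i ∈ stage F₀ t i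
  generates : stage F₀ t n = ⊤
  constants_eq : ∀ f : K, σ f = f → ∃ c ∈ constants σ₀, algebraMap F₀ K c = f

/-- The element `Δ(t_i) = σ t_i - t_i` of `F_{i-1}`. -/
def IsSigmaTower.delta {σ₀ : RingAut F₀} {σ : RingAut K} {n : ℕ} {t : Fin n → K}
    (h : IsSigmaTower σ₀ σ t) (i : Fin n) : stage F₀ t i :=
  ⟨σ (t i) - t i, h.delta_mem i⟩

/-- The `Θ₀`-canonical basis `{θ₀ θ₁ ⋯ θ_i | θ_j ∈ Θ_j}` of `F_i`, where `Θ_j` is the canonical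
`F_{j-1}`-basis of `F_j`. -/
def canonicalBasis (Θ₀ : Set F₀) {n : ℕ} (t : Fin n → K) : ℕ → Set K
  | 0 => algebraMap F₀ K '' Θ₀
  | i + 1 =>
    if h : i < n then
      Set.image2 (· * ·) (canonicalBasis Θ₀ t i) (canonicalStep (stage F₀ t i) (t ⟨i, h⟩))
    else canonicalBasis Θ₀ t i

/-- The indicator of `f`: the least `i` with `f ∈ F_i`. -/
noncomputable def indicator (F₀ : Type u) {K : Type v} [Field F₀] [Field K] [Algebra F₀ K]
    {n : ℕ} (t : Fin n → K) (f : K) : ℕ :=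
  sInf {i | f ∈ stage F₀ t i}

/-- `θ` is an element of the `Θ₀`-canonical basis of `F_i` that is effective for `r`
(that is, `θ^*(r) ≠ 0`) and has the same indicator as `r`. -/
def IsEffective (σ₀ : RingAut F₀) (Θ₀ : Set F₀) {n : ℕ} (t : Fin n → K) (i : ℕ)
    (r θ : K) : Prop :=
  θ ∈ canonicalBasis Θ₀ t i ∧
  (∃ c : constants σ₀, c ≠ 0 ∧ HasCoord (constants σ₀) (canonicalBasis Θ₀ t i) θ r c) ∧
  indicator F₀ t θ = indicator F₀ t r

/-- The initial segment `(t₁, …, t_{i+1})` of `(t₁, …, t_n)` (0-based: the entries up to `t i`). -/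
def initialSegment {n : ℕ} (t : Fin n → K) (i : Fin n) : Fin ((i : ℕ) + 1) → K :=
  fun j => t (Fin.castLE i.isLt j)

end Tower

/-- The construction of complete reductions in a tower leaves two things open for each generator
`t_{m+1}` over `F_m = F₀(t₁, …, t_m)`: the set of representatives of the `σ`-equivalence classes of
monic irreducible polynomials in `F_m[t_{m+1}]`, and the basis element effective for
`r = φ_m(Δ(t_{m+1}))`. A `Selection` fixes these choices, in an arbitrary way, for all towers
`(t₁, …, t_{m+1})` in all difference fields `(K, σ)` above `F₀`. It is only required to select an
admissible object whenever there is one. -/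
structure Selection {F₀ : Type u} [Field F₀] (σ₀ : RingAut F₀) (Θ₀ : Set F₀) where
  reps : ∀ {K : Type v} [Field K] [Algebra F₀ K], RingAut K → ∀ {m : ℕ}, (Fin (m + 1) → K) → Set K
  elt : ∀ {K : Type v} [Field K] [Algebra F₀ K], RingAut K → ∀ {m : ℕ}, (Fin (m + 1) → K) → K → K
  reps_spec : ∀ {K : Type v} [Field K] [Algebra F₀ K] (σ : RingAut K) {m : ℕ}
    (t : Fin (m + 1) → K),
    (∃ S, IsRepresentatives σ (stage F₀ t m) (t (Fin.last m)) S) →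
      IsRepresentatives σ (stage F₀ t m) (t (Fin.last m)) (reps σ t)
  elt_spec : ∀ {K : Type v} [Field K] [Algebra F₀ K] (σ : RingAut K) {m : ℕ}
    (t : Fin (m + 1) → K) (r : K),
    (∃ θ, IsEffective σ₀ Θ₀ t m r θ) → IsEffective σ₀ Θ₀ t m r (elt σ t r)

section Reductions

variable {F₀ : Type u} {K : Type v} [Field F₀] [Field K] [Algebra F₀ K]

/-- `φ₀, φ₁, …, φ_n` are the complete reductions for `Δ(F₀), …, Δ(F_n)` in a `Σ*`-tower: the first
one is the given one on `F₀`, and `φ_i` is the complete reduction for `Δ(F_i)` that establishes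
`F_i = Δ(F_i) ⊕ U_S ⊕ V_θ`, where `S` is the selected set of representatives in `F_{i-1}[t_i]` and
`θ` is the selected basis element effective for `φ_{i-1}(Δ(t_i))`. -/
structure IsTowerReduction {σ₀ : RingAut F₀} {Θ₀ : Set F₀}
    (φ₀ : F₀ →ₗ[constants σ₀] F₀) (sel : Selection.{u, v} σ₀ Θ₀) {σ : RingAut K} {n : ℕ}
    {t : Fin n → K} (ht : IsSigmaTower σ₀ σ t)
    (φ : ∀ i : ℕ, stage F₀ t i →ₗ[constants σ₀] stage F₀ t i) : Prop where
  base : ∀ f : F₀, φ 0 (algebraMap F₀ (stage F₀ t 0) f) = algebraMap F₀ (stage F₀ t 0) (φ₀ f)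
  representatives : ∀ i : Fin n,
    IsRepresentatives σ (stage F₀ t i) (t i) (sel.reps σ (initialSegment t i))
  effective : ∀ i : Fin n,
    IsEffective σ₀ Θ₀ t i (φ i (ht.delta i))
      (sel.elt σ (initialSegment t i) (φ i (ht.delta i)))
  complete : ∀ i : Fin n,
    IsCompleteReduction (summableIn σ (stage F₀ t ((i : ℕ) + 1))) (φ ((i : ℕ) + 1))
  image_eq : ∀ i : Fin n,
    {x : K | ∃ y ∈ LinearMap.range (φ ((i : ℕ) + 1)), (y : K) = x} =
      Set.image2 (· + ·)
        (properComplement (stage F₀ t i) (t i) (sel.reps σ (initialSegment t i)))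
        (polyComplement (stage F₀ t i) (t i) (φ i) (canonicalBasis Θ₀ t i)
          (sel.elt σ (initialSegment t i) (φ i (ht.delta i))))

/-- A `Σ*`-tower is well generated if `Δ(t_i) ∈ im φ_{i-1}` for each `i`, where `φ₀, …, φ_n` are
its complete reductions. -/
def IsWellGenerated {σ₀ : RingAut F₀} {Θ₀ : Set F₀}
    (φ₀ : F₀ →ₗ[constants σ₀] F₀) (sel : Selection.{u, v} σ₀ Θ₀) {σ : RingAut K} {n : ℕ}
    {t : Fin n → K} (ht : IsSigmaTower σ₀ σ t) : Prop :=
  ∃ φ : ∀ i : ℕ, stage F₀ t i →ₗ[constants σ₀] stage F₀ t i,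
    IsTowerReduction φ₀ sel ht φ ∧ ∀ i : Fin n, ht.delta i ∈ LinearMap.range (φ i)

end Reductions

end SigmaTower

/-! The field and its automorphism can stay; only the generators have to change. If `g` in the
previous stage satisfies `Δ(g) = Δ(t i) - φ(Δ(t i))`, then `t i - g` has difference `φ(Δ(t i))`,
which lies in the image of `φ`. Such a triangular substitution changes no stage and yields a tower
again (`stage_eq_of_sub_mem`, `IsSigmaTower.of_sub_mem`), so the isomorphism is the identity.

The corrections depend on the reductions, and the reductions depend on the generators through the
selected representatives and basis elements. Hence both are built together in
`exists_partial_reductions`. A later correction does not disturb earlier reductions, because a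
selection sees only an initial segment of the generators.

It remains to extend a complete reduction `φ` from `L` to `L(t)` when `Δ(t) = β`, that is, to prove
`L(t) = Δ(L(t)) ⊕ U_S ⊕ V_θ` (`exists_isCompleteReduction_step`). For spanning, partial fractions
are moved onto representatives by powers of `σ`, at the cost of an element of `Δ(L(t))`, and
polynomials are reduced from the top coefficient down (`exists_polynomial_reduction`). For
directness, polynomial and proper parts are separated. A pole of a proper `g` would give `σ g - g`
two different poles in one orbit, while `S` contains only one element per class
(`eq_zero_of_delta_mem_properComplement`). Polynomials are handled by their two top coefficients
(`eq_zero_of_coeff_twist_sub_mem`). Both polynomial arguments rest on `L = Δ(L) ⊕ C β ⊕ (im φ ∩ ker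
θ^*)`, which holds because `θ^*(φ β) ≠ 0`. -/

namespace SigmaTower

/-! ### The action of `σ` on polynomials. -/

section Twist

variable {L : Type*} [Field L]

/-- The automorphism of `L[X]` that acts as `s` on `L` and maps `X` to `X + β`. -/
noncomputable def twist (s : RingAut L) (β : L) : RingAut L[X] :=
  (Polynomial.mapEquiv s).trans (taylorEquiv β).toRingEquiv

variable (s : RingAut L) (β : L)

theorem twist_apply (p : L[X]) : twist s β p = taylor β (p.map (s : L →+* L)) := rfl

theorem natDegree_twist (p : L[X]) : (twist s β p).natDegree = p.natDegree := by
  rw [twist_apply, natDegree_taylor, natDegree_map]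

theorem degree_twist (p : L[X]) : (twist s β p).degree = p.degree := by
  rw [twist_apply, degree_taylor, degree_map]

theorem Monic.twist {p : L[X]} (hp : p.Monic) : (twist s β p).Monic := by
  rw [Monic, twist_apply, leadingCoeff_taylor]
  exact hp.map _

/-- Only the terms of degree `n` and `n + 1` contribute to this coefficient of the Taylor shift. The
factor `n + 1` is where characteristic zero matters later. -/
theorem coeff_twist {p : L[X]} {n : ℕ} (hp : p.natDegree ≤ n + 1) :
    (twist s β p).coeff n = s (p.coeff n) + (n + 1) * β * s (p.coeff (n + 1)) := by
  rw [twist_apply, taylor_apply, comp, eval₂_eq_sum_range' (n := n + 2)]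
  · rw [finsetSum_coeff, Finset.sum_range_succ, Finset.sum_range_succ, Finset.sum_eq_zero]
    · simp only [coeff_C_mul, coeff_X_add_C_pow, coeff_map]
      simp [mul_comm]
    · intro i hi
      simp [coeff_C_mul, coeff_X_add_C_pow, Nat.choose_eq_zero_of_lt (Finset.mem_range.1 hi)]
  · rw [natDegree_map]; omega

theorem coeff_twist_of_natDegree_le {p : L[X]} {n : ℕ} (hp : p.natDegree ≤ n) :
    (twist s β p).coeff n = s (p.coeff n) := by
  rw [coeff_twist s β (hp.trans n.le_succ), coeff_eq_zero_of_natDegree_lt (Nat.lt_succ_of_le hp)]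
  simp

theorem twist_dvd_twist {p q : L[X]} : twist s β p ∣ twist s β q ↔ p ∣ q := by
  constructor
  · rintro ⟨c, hc⟩
    obtain ⟨c, rfl⟩ := (twist s β).surjective c
    exact ⟨c, (twist s β).injective (by rw [hc, map_mul])⟩
  · rintro ⟨c, rfl⟩
    exact ⟨twist s β c, map_mul _ _ _⟩

theorem irreducible_zpow_twist {p : L[X]} (hp : Irreducible p) (ℓ : ℤ) :
    Irreducible ((twist s β ^ ℓ) p) :=
  (MulEquiv.irreducible_iff (RingEquiv.toMulEquiv (twist s β ^ ℓ))).2 hp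

theorem monic_zpow_twist {p : L[X]} (hp : p.Monic) (ℓ : ℤ) : ((twist s β ^ ℓ) p).Monic := by
  induction ℓ with
  | zero => simpa
  | succ k ih => rw [add_comm, zpow_one_add, RingAut.mul_apply]; exact Monic.twist s β ih
  | pred k ih =>
    have h : twist s β ((twist s β ^ (-(k : ℤ) - 1)) p) = (twist s β ^ (-(k : ℤ))) p := by
      rw [← RingAut.mul_apply, ← zpow_one_add]; congr 2; ring
    rw [← h, Monic, twist_apply, leadingCoeff_taylor] at ih
    rw [leadingCoeff_map] at ih
    exact (map_eq_one_iff _ s.injective).1 ih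

theorem natDegree_zpow_twist (p : L[X]) (ℓ : ℤ) :
    ((twist s β ^ ℓ) p).natDegree = p.natDegree := by
  induction ℓ with
  | zero => simp
  | succ k ih => rw [add_comm, zpow_one_add, RingAut.mul_apply, natDegree_twist, ih]
  | pred k ih =>
    have h : twist s β ((twist s β ^ (-(k : ℤ) - 1)) p) = (twist s β ^ (-(k : ℤ))) p := by
      rw [← RingAut.mul_apply, ← zpow_one_add]; congr 2; ring
    rw [← natDegree_twist s β, h, ih]

theorem degree_zpow_twist (p : L[X]) (ℓ : ℤ) : ((twist s β ^ ℓ) p).degree = p.degree := by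
  rcases eq_or_ne p 0 with rfl | hp
  · rw [map_zero]
  · have h : (twist s β ^ ℓ) p ≠ 0 := (map_ne_zero_iff _ (twist s β ^ ℓ).injective).2 hp
    rw [degree_eq_natDegree h, degree_eq_natDegree hp, natDegree_zpow_twist]

end Twist

/-- `σ` extends `s` and maps `t` to `t + β`. -/
structure IsShift {L K : Type*} [Field L] [Field K] [Algebra L K] (s : RingAut L) (β : L)
    (σ : RingAut K) (t : K) : Prop where
  base : ∀ c : L, σ (algebraMap L K c) = algebraMap L K (s c)
  gen : σ t = t + algebraMap L K β

/-! ### Poles of rational functions and aperiodicity of `σ` on irreducibles. -/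

section Fractions

variable {L K : Type*} [Field L] [Field K] [Algebra L K] {t : K}

theorem aeval_ne_zero (ht : Transcendental L t) {p : L[X]} (hp : p ≠ 0) : aeval t p ≠ 0 :=
  fun h => hp ((transcendental_iff.1 ht) p h)

theorem aeval_inj (ht : Transcendental L t) {p q : L[X]} : aeval t p = aeval t q ↔ p = q :=
  (transcendental_iff_injective.1 ht).eq_iff

theorem IsShift.map_aeval {s : RingAut L} {β : L} {σ : RingAut K} (h : IsShift s β σ t) (p : L[X]) :
    σ (aeval t p) = aeval t (twist s β p) := by
  induction p using Polynomial.induction_on' with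
  | add p q hp hq => simp only [map_add, hp, hq]
  | monomial n a =>
    rw [twist_apply, map_monomial, taylor_monomial, aeval_monomial, map_mul, map_pow, h.base, h.gen]
    simp

theorem IsShift.zpow_aeval {s : RingAut L} {β : L} {σ : RingAut K} (h : IsShift s β σ t) (p : L[X])
    (ℓ : ℤ) : (σ ^ ℓ) (aeval t p) = aeval t ((twist s β ^ ℓ) p) := by
  induction ℓ with
  | zero => simp
  | succ k ih =>
    rw [add_comm, zpow_one_add, RingAut.mul_apply, ih, h.map_aeval, zpow_one_add, RingAut.mul_apply]
  | pred k ih =>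
    apply σ.injective
    rw [h.map_aeval, ← RingAut.mul_apply, ← RingAut.mul_apply, ← zpow_one_add, ← zpow_one_add]
    rwa [add_sub_cancel]

/-- `f` has no pole at `q`. -/
def IsRegularAt (t : K) (q : L[X]) (f : K) : Prop :=
  ∃ a b : L[X], ¬ q ∣ b ∧ f = aeval t a / aeval t b

theorem IsRegularAt.sub (ht : Transcendental L t) {q : L[X]} (hq : Prime q) {f g : K}
    (hf : IsRegularAt t q f) (hg : IsRegularAt t q g) : IsRegularAt t q (f - g) := by
  obtain ⟨a, b, hb, rfl⟩ := hf
  obtain ⟨c, d, hd, rfl⟩ := hg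
  refine ⟨a * d - b * c, b * d, fun h => (hq.dvd_or_dvd h).elim hb hd, ?_⟩
  have hb0 := aeval_ne_zero ht (p := b) (by rintro rfl; exact hb (dvd_zero q))
  have hd0 := aeval_ne_zero ht (p := d) (by rintro rfl; exact hd (dvd_zero q))
  simp only [map_sub, map_mul]
  field_simp

theorem IsShift.isRegularAt_iff {s : RingAut L} {β : L} {σ : RingAut K} (h : IsShift s β σ t)
    {q : L[X]} {f : K} : IsRegularAt t (twist s β q) (σ f) ↔ IsRegularAt t q f := by
  constructor
  · rintro ⟨a, b, hb, hf⟩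
    obtain ⟨a, rfl⟩ := (twist s β).surjective a
    obtain ⟨b, rfl⟩ := (twist s β).surjective b
    refine ⟨a, b, fun hd => hb ((twist_dvd_twist s β).2 hd), σ.injective ?_⟩
    rw [hf, map_div₀, h.map_aeval, h.map_aeval]
  · rintro ⟨a, b, hb, rfl⟩
    refine ⟨twist s β a, twist s β b, fun hd => hb ((twist_dvd_twist s β).1 hd), ?_⟩
    rw [map_div₀, h.map_aeval, h.map_aeval]

theorem eq_of_dvd_of_monic {p q : L[X]} (hp : Irreducible p) (hq : Irreducible q) (hpm : p.Monic)
    (hqm : q.Monic) (h : p ∣ q) : p = q :=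
  eq_of_monic_of_associated hpm hqm (hp.associated_of_dvd hq h)

theorem finite_monic_irreducible_dvd {b : L[X]} (hb : b ≠ 0) :
    {q : L[X] | q.Monic ∧ Irreducible q ∧ q ∣ b}.Finite := by
  classical
  refine (UniqueFactorizationMonoid.normalizedFactors b).toFinset.finite_toSet.subset ?_
  rintro q ⟨hm, hq, hd⟩
  simp only [Multiset.mem_toFinset, SetLike.mem_coe]
  exact (UniqueFactorizationMonoid.mem_normalizedFactors_iff' hb).2 ⟨hq, hm.normalize_eq_self, hd⟩

/-- A twist-periodic monic irreducible polynomial yields a new constant. -/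
theorem IsShift.zpow_twist_ne (ht : Transcendental L t) {s : RingAut L} {β : L} {σ : RingAut K}
    (h : IsShift s β σ t) (hc : ∀ f : K, σ f = f → ∃ c : L, algebraMap L K c = f) {q : L[X]}
    (hm : q.Monic) (hq : Irreducible q) {ℓ : ℤ} (hℓ : (twist s β ^ ℓ) q = q) : ℓ = 0 := by
  have key : ∀ k : ℕ, (twist s β ^ (k + 1)) q ≠ q := by
    intro k hk
    -- The twist permutes the factors of this orbit product cyclically, so `aeval t x` is a constant
    -- and lies in `L`. Then `x` has degree zero, although `q` divides it.
    set x := ∏ i ∈ Finset.range (k + 1), (twist s β ^ i) q with hx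
    have hxm : x.Monic := monic_prod_of_monic _ _ fun i _ => by
      simpa using monic_zpow_twist s β hm i
    have hfix : twist s β x = x := by
      rw [hx, map_prod, Finset.prod_range_succ, Finset.prod_range_succ', ← RingAut.mul_apply,
        ← pow_succ', hk]
      simp only [← RingAut.mul_apply, ← pow_succ']
      simp
    obtain ⟨c, hcx⟩ := hc (aeval t x) (by rw [h.map_aeval, hfix])
    have hxC : x = C c := by
      rw [← aeval_inj ht, ← hcx]; simp
    have hdvd : q ∣ x := by
      rw [hx, Finset.prod_range_succ']; rw [pow_zero]; exact Dvd.intro_left _ rfl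
    have h1 := natDegree_le_of_dvd hdvd hxm.ne_zero
    have h2 := hq.natDegree_pos
    rw [hxC, natDegree_C] at h1
    omega
  obtain ⟨n, rfl | rfl⟩ := ℓ.eq_nat_or_neg
  · cases n with
    | zero => rfl
    | succ k => exact absurd (by exact_mod_cast hℓ) (key k)
  · cases n with
    | zero => rfl
    | succ k =>
      refine absurd ?_ (key k)
      conv_lhs => rw [← hℓ]
      rw [← RingAut.mul_apply, zpow_neg, zpow_natCast, mul_inv_cancel]
      rfl

theorem isUnit_of_isRegularAt (ht : Transcendental L t) {a b : L[X]} (hb : b ≠ 0)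
    (hab : IsCoprime a b)
    (h : ∀ q : L[X], q.Monic → Irreducible q → IsRegularAt t q (aeval t a / aeval t b)) :
    IsUnit b := by
  by_contra hu
  obtain ⟨q, hm, hq, hqb⟩ := exists_monic_irreducible_factor b hu
  obtain ⟨c, d, hd, he⟩ := h q hm hq
  have hd0 : d ≠ 0 := by rintro rfl; exact hd (dvd_zero q)
  rw [div_eq_div_iff (aeval_ne_zero ht hb) (aeval_ne_zero ht hd0), ← map_mul, ← map_mul,
    aeval_inj ht] at he
  have h1 : q ∣ a * d := he ▸ hqb.mul_left c
  have h2 : q ∣ a := (hq.prime.dvd_or_dvd h1).resolve_right hd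
  exact hq.not_isUnit (hab.isUnit_of_dvd' h2 hqb)

end Fractions

/-! ### Partial fractions: the canonical basis of `L(t)` over `L`. -/

section CanonicalStep

variable {F₀ : Type u} {K : Type v} [Field F₀] [Field K] [Algebra F₀ K]
  {L : IntermediateField F₀ K} {t : K}

theorem aeval_mem_span_canonicalStep (p : L[X]) :
    aeval t p ∈ Submodule.span L (canonicalStep L t) := by
  rw [aeval_eq_sum_range]
  exact Submodule.sum_mem _ fun k _ =>
    Submodule.smul_mem _ _ (Submodule.subset_span (Or.inl ⟨k, rfl⟩))

/-- Expansion of the numerator in base `q`: each division by `q` leaves a remainder of degree below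
`deg q`, which accounts for one pole order. -/
theorem div_pow_mem_span_canonicalStep (ht : Transcendental L t) {q : L[X]} (hm : q.Monic)
    (hq : Irreducible q) (j : ℕ) (a : L[X]) :
    aeval t a / aeval t q ^ j ∈ Submodule.span L (canonicalStep L t) := by
  induction j generalizing a with
  | zero => simpa using aeval_mem_span_canonicalStep a
  | succ j ih =>
    have hq0 := aeval_ne_zero ht hm.ne_zero
    have h : aeval t a / aeval t q ^ (j + 1) =
        aeval t (a / q) / aeval t q ^ j + aeval t (a % q) / aeval t q ^ (j + 1) := by
      conv_lhs => rw [← EuclideanDomain.div_add_mod a q, map_add, map_mul]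
      field_simp
      ring
    rw [h]
    refine add_mem (ih _) ?_
    rw [aeval_eq_sum_range, Finset.sum_div]
    refine Submodule.sum_mem _ fun k hk => ?_
    have hdeg : (a % q).natDegree < q.natDegree :=
      natDegree_mod_lt a hq.natDegree_pos.ne'
    rw [smul_div_assoc]
    refine Submodule.smul_mem _ _ (Submodule.subset_span (Or.inr ⟨q, hm, hq, k, j + 1, ?_⟩))
    have := Finset.mem_range.1 hk
    exact ⟨by omega, by omega, rfl⟩

/-- A Bézout relation splits the fraction along coprime factors of the denominator. What remains are
prime powers, whose base is normalized to be monic. -/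
theorem div_mem_span_canonicalStep (ht : Transcendental L t) (a b : L[X]) :
    aeval t a / aeval t b ∈ Submodule.span L (canonicalStep L t) := by
  induction b using UniqueFactorizationMonoid.induction_on_coprime generalizing a with
  | h0 => simp
  | @h1 b hb =>
    obtain ⟨c, hc, rfl⟩ := isUnit_iff.1 hb
    have : aeval t a / aeval t (C c) = c⁻¹ • aeval t a := by
      rw [aeval_C, Algebra.smul_def, map_inv₀, div_eq_inv_mul]
    rw [this]
    exact Submodule.smul_mem _ _ (aeval_mem_span_canonicalStep a)
  | @hpr p i hp =>
    have hl : p.leadingCoeff ≠ 0 := leadingCoeff_ne_zero.2 hp.ne_zero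
    have hm : (p * C p.leadingCoeff⁻¹).Monic := monic_mul_leadingCoeff_inv hp.ne_zero
    have hirr : Irreducible (p * C p.leadingCoeff⁻¹) :=
      (irreducible_mul_isUnit (isUnit_C.2 (inv_ne_zero hl).isUnit)).2 hp.irreducible
    have := div_pow_mem_span_canonicalStep ht hm hirr i (a * C (p.leadingCoeff⁻¹ ^ i))
    convert this using 1
    have h1 : algebraMap L K p.leadingCoeff ≠ 0 := by simpa using hl
    have h2 := aeval_ne_zero ht hp.ne_zero
    simp only [map_mul, map_pow, aeval_C, mul_pow]
    rw [mul_div_mul_right]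
    exact pow_ne_zero _ (by rw [map_inv₀]; exact inv_ne_zero h1)
  | @hcp x y hxy hx hy =>
    rcases eq_or_ne x 0 with rfl | hx0
    · simp
    rcases eq_or_ne y 0 with rfl | hy0
    · simp
    obtain ⟨u, v, huv⟩ := hxy.isCoprime
    have h : aeval t a / aeval t (x * y) =
        aeval t (a * v) / aeval t x + aeval t (a * u) / aeval t y := by
      have h1 := aeval_ne_zero ht hx0
      have h2 := aeval_ne_zero ht hy0
      have h3 : aeval t u * aeval t x + aeval t v * aeval t y = 1 := by
        rw [← map_mul, ← map_mul, ← map_add, huv, map_one]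
      simp only [map_mul]
      field_simp
      linear_combination (-(aeval t a)) * h3
    rw [h]
    exact add_mem (hx _) (hy _)

/-- The indices of the canonical basis elements with a denominator; the pole orders are shifted
by one. -/
abbrev PoleIndex (L : Type*) [Field L] : Type _ :=
  Σ q : {q : L[X] // q.Monic ∧ Irreducible q}, ℕ × Fin q.1.natDegree

/-- The canonical basis elements as a family. -/
noncomputable def canonicalFamily (L : IntermediateField F₀ K) (t : K) :
    ℕ ⊕ PoleIndex L → K :=
  Sum.elim (fun k => t ^ k) fun i => t ^ (i.2.2 : ℕ) / aeval t i.1.1 ^ (i.2.1 + 1)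

theorem range_canonicalFamily (L : IntermediateField F₀ K) (t : K) :
    Set.range (canonicalFamily L t) = canonicalStep L t := by
  ext x
  constructor
  · rintro ⟨k | ⟨⟨q, hm, hq⟩, j, k⟩, rfl⟩
    · exact Or.inl ⟨k, rfl⟩
    · exact Or.inr ⟨q, hm, hq, k, j + 1, k.2, by omega, rfl⟩
  · rintro (⟨k, rfl⟩ | ⟨q, hm, hq, k, j, hk, hj, rfl⟩)
    · exact ⟨Sum.inl k, rfl⟩
    · refine ⟨Sum.inr ⟨⟨q, hm, hq⟩, j - 1, k, hk⟩, ?_⟩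
      simp [canonicalFamily, Nat.sub_add_cancel hj]

/-- A linear relation is a partial fraction decomposition of `0`, with polynomial part `Q` and
numerators `r q j`. Uniqueness of such decompositions makes all of these vanish. -/
theorem linearIndependent_canonicalFamily (ht : Transcendental L t) :
    LinearIndependent L (canonicalFamily L t) := by
  classical
  let _ : Algebra L[X] K := (aeval t).toRingHom.toAlgebra
  have halg : ∀ p : L[X], algebraMap L[X] K p = aeval t p := fun _ => rfl
  have : FaithfulSMul L[X] K :=
    (faithfulSMul_iff_algebraMap_injective _ _).2 (transcendental_iff_injective.1 ht)
  rw [linearIndependent_iff]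
  intro l hl
  set s : Finset {q : L[X] // q.Monic ∧ Irreducible q} :=
    l.support.toRight.image Sigma.fst with hs
  obtain ⟨N, hN⟩ : ∃ N, ∀ i ∈ l.support.toRight, i.2.1 < N := by
    refine ⟨(l.support.toRight.sup fun i => i.2.1) + 1, fun i hi => Nat.lt_succ_of_le ?_⟩
    exact Finset.le_sup (f := fun i : PoleIndex L => i.2.1) hi
  let Q : L[X] := ∑ k ∈ l.support.toLeft, monomial k (l (Sum.inl k))
  let r : (q : {q : L[X] // q.Monic ∧ Irreducible q}) → Fin N → L[X] := fun q j =>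
    ∑ k : Fin q.1.natDegree, monomial k (l (Sum.inr ⟨q, j, k⟩))
  have hdeg : ∀ q j, (r q j).degree < q.1.degree := by
    intro q j
    rw [degree_eq_natDegree q.2.1.ne_zero]
    refine (degree_sum_le _ _).trans_lt ?_
    rw [Finset.sup_lt_iff (WithBot.bot_lt_coe _)]
    intro k _
    exact (degree_monomial_le _ _).trans_lt (by exact_mod_cast k.2)
  have key := quo_add_sum_rem_mul_pow_inverse_unique (K := K) (s := s) (g := fun q => q.1)
    (gi := fun q => (aeval t q.1)⁻¹) (n := fun _ => N) (q₁ := Q) (q₂ := 0) (r₁ := r)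
    (r₂ := fun _ _ => 0) (fun q _ => q.2.1) ?_ ?_ ?_ ?_ ?_
  · obtain ⟨hQ, hr⟩ := key
    refine Finsupp.ext fun i => ?_
    rw [Finsupp.zero_apply]
    by_contra hi
    have hmem := Finsupp.mem_support_iff.2 hi
    rcases i with k | ⟨q, j, k⟩
    · have := congrArg (fun p => p.coeff k) hQ
      simp only [Q, finsetSum_coeff, coeff_monomial, Finset.sum_ite_eq', coeff_zero] at this
      rw [if_pos (Finset.mem_toLeft.2 hmem)] at this
      exact hi this
    · have hm := Finset.mem_toRight.2 hmem
      have hq : q ∈ s := Finset.mem_image.2 ⟨_, hm, rfl⟩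
      have := congrArg (fun p => p.coeff k) (congrFun (hr q hq) ⟨j, hN _ hm⟩)
      simp only [r, finsetSum_coeff, coeff_monomial, coeff_zero, Fin.val_inj, Finset.sum_ite_eq',
        Finset.mem_univ, if_true] at this
      exact hi this
  · intro p _ q _ hpq
    refine (p.2.2.coprime_iff_not_dvd).2 fun h => hpq (Subtype.ext ?_)
    exact eq_of_dvd_of_monic p.2.2 q.2.2 p.2.1 q.2.1 h
  · intro q _
    rw [halg, inv_mul_cancel₀ (aeval_ne_zero ht q.2.1.ne_zero)]
  · exact fun q _ j => hdeg q j
  · intro q _ j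
    rw [degree_zero]
    exact bot_lt_iff_ne_bot.2 (degree_ne_bot.2 q.2.1.ne_zero)
  · simp only [halg, map_zero, zero_mul, Finset.sum_const_zero, add_zero]
    rw [← hl, Finsupp.linearCombination_apply, Finsupp.sum]
    -- The sum is padded with zero coefficients to the full box of pole orders below `N`, as the
    -- uniqueness statement uses all orders up to a bound.
    have hright : ∑ i ∈ l.support.toRight, l (Sum.inr i) • canonicalFamily L t (Sum.inr i) =
        ∑ i ∈ s.sigma fun q => Finset.range N ×ˢ (Finset.univ : Finset (Fin q.1.natDegree)),
          l (Sum.inr i) • canonicalFamily L t (Sum.inr i) := by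
      refine Finset.sum_subset (fun i hi => ?_) fun i _ hi => ?_
      · simpa using ⟨Finset.mem_image_of_mem _ hi, hN i hi⟩
      · rw [Finset.mem_toRight, Finsupp.notMem_support_iff] at hi
        rw [hi, zero_smul]
    rw [← Finset.toLeft_disjSum_toRight (u := l.support), Finset.sum_disjSum, hright,
      Finset.sum_sigma]
    congr 1
    · simp [Q, canonicalFamily, aeval_monomial, Algebra.smul_def]
    · refine Finset.sum_congr rfl fun q _ => ?_
      rw [Finset.sum_product, Finset.sum_range]
      refine Finset.sum_congr rfl fun j _ => ?_
      simp only [r, map_sum, Finset.sum_mul]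
      refine Finset.sum_congr rfl fun k _ => ?_
      simp [canonicalFamily, aeval_monomial, Algebra.smul_def, div_eq_mul_inv, mul_assoc]

end CanonicalStep

/-! ### Coordinates in a basis and complete reductions as projections. -/

section Coordinates

variable {C : Type u} {V : Type v} [Field C] [AddCommGroup V] [Module C V] {B : Set V} {θ f g : V}
  {c d : C}

theorem HasCoord.add (hf : HasCoord C B θ f c) (hg : HasCoord C B θ g d) :
    HasCoord C B θ (f + g) (c + d) := by
  obtain ⟨l, hl, rfl, rfl⟩ := hf
  obtain ⟨m, hm, rfl, rfl⟩ := hg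
  exact ⟨l + m, add_mem hl hm, map_add _ _ _, rfl⟩

theorem HasCoord.smul (a : C) (hf : HasCoord C B θ f c) : HasCoord C B θ (a • f) (a * c) := by
  obtain ⟨l, hl, rfl, rfl⟩ := hf
  exact ⟨a • l, Submodule.smul_mem _ _ hl, map_smul _ _ _, rfl⟩

theorem HasCoord.zero : HasCoord C B θ 0 0 := ⟨0, zero_mem _, map_zero _, rfl⟩

theorem HasCoord.unique (hB : LinearIndepOn C id B) (hf : HasCoord C B θ f c)
    (hg : HasCoord C B θ f d) : c = d := by
  obtain ⟨l, hl, rfl, rfl⟩ := hf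
  obtain ⟨m, hm, h, rfl⟩ := hg
  have := linearIndepOn_iff.1 hB (l - m) (sub_mem hl hm) (by rw [map_sub, h, sub_self])
  rw [sub_eq_zero.1 this]

theorem exists_hasCoord (θ : V) (hf : f ∈ Submodule.span C B) : ∃ c, HasCoord C B θ f c := by
  rw [← Set.image_id B, Finsupp.mem_span_image_iff_linearCombination] at hf
  obtain ⟨l, hl, rfl⟩ := hf
  exact ⟨l θ, l, hl, rfl, rfl⟩

end Coordinates

section Reduction

variable {C : Type u} {V : Type v} [Field C] [AddCommGroup V] [Module C V] {U : Set V}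
  {φ : V →ₗ[C] V}

theorem IsCompleteReduction.apply_eq_zero_iff (h : IsCompleteReduction U φ) {f : V} :
    φ f = 0 ↔ f ∈ U := by
  rw [← h.2]; exact LinearMap.mem_ker.symm

theorem IsCompleteReduction.apply_of_mem_range (h : IsCompleteReduction U φ) {f : V}
    (hf : f ∈ LinearMap.range φ) : φ f = f := by
  obtain ⟨g, rfl⟩ := hf
  have := h.apply_eq_zero_iff.2 (h.1 g)
  rw [map_sub, sub_eq_zero] at this
  exact this.symm

theorem exists_isCompleteReduction {D W : Submodule C V} (h : IsCompl D W) :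
    ∃ φ : V →ₗ[C] V, IsCompleteReduction (D : Set V) φ ∧ LinearMap.range φ = W := by
  refine ⟨W.projection D h.symm, ⟨fun f => ?_, ?_⟩, ?_⟩
  · rw [SetLike.mem_coe, ← Submodule.projection_apply_eq_zero_iff h.symm, map_sub, sub_eq_zero]
    exact (Submodule.projection_apply_left h.symm ⟨_, Submodule.projection_apply_mem h.symm f⟩).symm
  · rw [Submodule.ker_projection]
  · rw [Submodule.range_projection]

end Reduction

/-! ### Proper fractions and the complement `U_S`. -/

section Proper

variable {F₀ : Type u} {K : Type v} [Field F₀] [Field K] [Algebra F₀ K]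
  {L : IntermediateField F₀ K} {t : K} {σ : RingAut K} {s : RingAut L} {β : L}

/-- Membership asks for lowest terms and a monic denominator, so the gcd and the leading coefficient
are cancelled; the degree inequality survives both. -/
theorem div_mem_properFractions (ht : Transcendental L t) {a b : L[X]} (h : a.degree < b.degree) :
    aeval t a / aeval t b ∈ properFractions L t := by
  classical
  have hb : b ≠ 0 := ne_zero_of_degree_gt h
  have hg : EuclideanDomain.gcd a b ≠ 0 := fun h0 => hb (EuclideanDomain.gcd_eq_zero_iff.1 h0).2
  obtain ⟨x, y, hxy⟩ : ∃ x y, EuclideanDomain.gcd a b = x * a + y * b :=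
    ⟨_, _, by rw [EuclideanDomain.gcd_eq_gcd_ab a b, mul_comm a, mul_comm b]⟩
  obtain ⟨a', ha'⟩ := EuclideanDomain.gcd_dvd_left a b
  obtain ⟨b', hb'⟩ := EuclideanDomain.gcd_dvd_right a b
  set g := EuclideanDomain.gcd a b
  have hb0 : b' ≠ 0 := by rintro rfl; exact hb (by rw [hb', mul_zero])
  have hco : IsCoprime a' b' := by
    refine ⟨x, y, mul_left_cancel₀ hg ?_⟩
    rw [mul_one]
    conv_rhs => rw [hxy, ha', hb']
    ring
  have hlt : a'.degree < b'.degree := by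
    rw [ha', hb', degree_mul, degree_mul] at h
    exact lt_of_add_lt_add_left h
  have hc : b'.leadingCoeff⁻¹ ≠ 0 := inv_ne_zero (leadingCoeff_ne_zero.2 hb0)
  have hu : IsUnit (C b'.leadingCoeff⁻¹) := isUnit_C.2 hc.isUnit
  refine ⟨a' * C b'.leadingCoeff⁻¹, b' * C b'.leadingCoeff⁻¹, monic_mul_leadingCoeff_inv hb0,
    (isCoprime_mul_unit_right hu _ _).2 hco, by rwa [degree_mul_C hc, degree_mul_C hc], ?_⟩
  rw [ha', hb', map_mul, map_mul, map_mul, map_mul, mul_div_mul_left _ _ (aeval_ne_zero ht hg),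
    mul_div_mul_right _ _ (aeval_ne_zero ht (C_ne_zero.2 hc))]

theorem zero_mem_properFractions : (0 : K) ∈ properFractions L t :=
  ⟨0, 1, monic_one, isCoprime_one_right, by simp, by simp⟩

theorem add_mem_properFractions (ht : Transcendental L t) {f g : K} (hf : f ∈ properFractions L t)
    (hg : g ∈ properFractions L t) : f + g ∈ properFractions L t := by
  obtain ⟨a, b, hb, -, hab, rfl⟩ := hf
  obtain ⟨c, d, hd, -, hcd, rfl⟩ := hg
  rw [div_add_div _ _ (aeval_ne_zero ht hb.ne_zero) (aeval_ne_zero ht hd.ne_zero), ← map_mul,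
    ← map_mul, ← map_mul, ← map_add]
  refine div_mem_properFractions ht ((degree_add_le _ _).trans_lt (max_lt ?_ ?_))
  · rw [degree_mul, degree_mul]
    exact WithBot.add_lt_add_right (degree_ne_bot.2 hd.ne_zero) hab
  · rw [degree_mul, degree_mul]
    exact WithBot.add_lt_add_left (degree_ne_bot.2 hb.ne_zero) hcd

theorem mul_mem_properFractions (ht : Transcendental L t) (c : L) {f : K}
    (hf : f ∈ properFractions L t) : (c : K) * f ∈ properFractions L t := by
  obtain ⟨a, b, hb, -, hab, rfl⟩ := hf
  have h : (c : K) * (aeval t a / aeval t b) = aeval t (C c * a) / aeval t b := by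
    rw [map_mul, aeval_C, mul_div_assoc]; rfl
  rw [h]
  refine div_mem_properFractions ht ?_
  rcases eq_or_ne c 0 with rfl | hc
  · simpa [bot_lt_iff_ne_bot] using hb.ne_zero
  · rwa [degree_C_mul hc]

theorem eq_zero_of_aeval_mem_properFractions (ht : Transcendental L t) {p : L[X]}
    (hp : aeval t p ∈ properFractions L t) : p = 0 := by
  obtain ⟨a, b, hb, -, hab, h⟩ := hp
  rw [eq_div_iff (aeval_ne_zero ht hb.ne_zero), ← map_mul, aeval_inj ht] at h
  by_contra hp0
  rw [← h, degree_mul] at hab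
  refine hab.not_ge ?_
  rw [degree_eq_natDegree hp0, degree_eq_natDegree hb.ne_zero]
  exact_mod_cast Nat.le_add_left _ _

theorem exists_aeval_add_proper (ht : Transcendental L t) (a b : L[X]) :
    ∃ p : L[X], ∃ g ∈ properFractions L t, aeval t a / aeval t b = aeval t p + g := by
  rcases eq_or_ne b 0 with rfl | hb
  · exact ⟨0, 0, zero_mem_properFractions, by simp⟩
  · refine ⟨a / b, aeval t (a % b) / aeval t b,
      div_mem_properFractions ht (EuclideanDomain.mod_lt a hb), ?_⟩
    have := aeval_ne_zero ht hb
    conv_lhs => rw [← EuclideanDomain.div_add_mod a b, map_add, map_mul]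
    field_simp

theorem IsShift.map_mem_properFractions (h : IsShift s β σ t) (ht : Transcendental L t) {f : K}
    (hf : f ∈ properFractions L t) : σ f ∈ properFractions L t := by
  obtain ⟨a, b, hb, -, hab, rfl⟩ := hf
  rw [map_div₀, h.map_aeval, h.map_aeval]
  exact div_mem_properFractions ht (by rwa [degree_twist, degree_twist])

theorem sub_mem_properFractions (ht : Transcendental L t) {f g : K} (hf : f ∈ properFractions L t)
    (hg : g ∈ properFractions L t) : f - g ∈ properFractions L t := by
  have := add_mem_properFractions ht hf (mul_mem_properFractions ht (-1) hg)
  simpa [sub_eq_add_neg] using this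

theorem exists_of_mem_closure {S : Set K} (hS : S ⊆ monicIrreducibles L t)
    {d : K} (hd : d ∈ Submonoid.closure S) :
    ∃ D : L[X], D.Monic ∧ d = aeval t D ∧
      ∀ q : L[X], q.Monic → Irreducible q → q ∣ D → aeval t q ∈ S := by
  induction hd using Submonoid.closure_induction with
  | mem x hx =>
    obtain ⟨p, hp, hpi, rfl⟩ := hS hx
    refine ⟨p, hp, rfl, fun q hq hqi hd => ?_⟩
    rwa [eq_of_dvd_of_monic hqi hpi hq hp hd]
  | one => exact ⟨1, monic_one, by simp, fun q _ hqi hd => absurd (isUnit_of_dvd_one hd) hqi.1⟩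
  | mul x y _ _ hx hy =>
    obtain ⟨D, hD, rfl, h1⟩ := hx
    obtain ⟨E, hE, rfl, h2⟩ := hy
    exact ⟨D * E, hD.mul hE, by simp, fun q hq hqi hd =>
      (hqi.prime.dvd_or_dvd hd).elim (h1 q hq hqi) (h2 q hq hqi)⟩

theorem mem_of_not_isRegularAt {S : Set K} (hS : S ⊆ monicIrreducibles L t)
    {f : K} (hf : f ∈ properComplement L t S) {q : L[X]} (hm : q.Monic)
    (hq : Irreducible q) (h : ¬ IsRegularAt t q f) : aeval t q ∈ S := by
  obtain ⟨-, a, d, hd, rfl⟩ := hf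
  obtain ⟨D, -, rfl, hS⟩ := exists_of_mem_closure hS hd
  exact hS q hm hq (by_contra fun hqD => h ⟨a, D, hqD, rfl⟩)

theorem sigmaEquiv_zpow_twist (h : IsShift s β σ t) (q : L[X]) (ℓ : ℤ) :
    SigmaEquiv σ L (aeval t ((twist s β ^ ℓ) q)) (aeval t q) :=
  ⟨1, one_ne_zero, ℓ, by rw [h.zpow_aeval]; simp⟩

theorem eq_of_mem_representatives (h : IsShift s β σ t) {S : Set K}
    (hS : IsRepresentatives σ L t S) {q : L[X]} (hm : q.Monic) (hq : Irreducible q) {k ℓ : ℤ}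
    (hk : aeval t ((twist s β ^ k) q) ∈ S) (hℓ : aeval t ((twist s β ^ ℓ) q) ∈ S) :
    aeval t ((twist s β ^ k) q) = aeval t ((twist s β ^ ℓ) q) :=
  (hS.2 _ ⟨q, hm, hq, rfl⟩).unique ⟨hk, sigmaEquiv_zpow_twist h q k⟩
    ⟨hℓ, sigmaEquiv_zpow_twist h q ℓ⟩

/-- A proper fraction whose difference lies in `U_S` is zero. -/
theorem eq_zero_of_delta_mem_properComplement (ht : Transcendental L t) (h : IsShift s β σ t)
    (hc : ∀ f : K, σ f = f → ∃ c : L, algebraMap L K c = f) {S : Set K}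
    (hS : IsRepresentatives σ L t S) {g : K} (hg : g ∈ properFractions L t)
    (hu : σ g - g ∈ properComplement L t S) : g = 0 := by
  have hreg : ∀ q : L[X], q.Monic → Irreducible q → IsRegularAt t q g := by
    intro q hm hq
    by_contra hpole
    let τ : ℤ → L[X] := fun k => (twist s β ^ k) q
    have hτm : ∀ k, (τ k).Monic := monic_zpow_twist s β hm
    have hτi : ∀ k, Irreducible (τ k) := irreducible_zpow_twist s β hq
    have hτ : ∀ k, twist s β (τ k) = τ (k + 1) := fun k => by
      simp only [τ]; rw [add_comm, zpow_one_add, RingAut.mul_apply]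
    have hinj : Function.Injective τ := by
      intro k ℓ hkl
      refine sub_eq_zero.1 (h.zpow_twist_ne ht hc (hτm ℓ) (hτi ℓ) (ℓ := k - ℓ) ?_)
      simp only [τ] at hkl ⊢
      rw [← RingAut.mul_apply, ← zpow_add, sub_add_cancel, hkl]
    -- The poles of `g` in the orbit of `q`. There are finitely many, since each divides the
    -- denominator and `τ` is injective.
    let Z : Set ℤ := {k | ¬ IsRegularAt t (τ k) g}
    have hZ : Z.Finite := by
      obtain ⟨a, b, hb, -, -, rfl⟩ := hg
      refine ((finite_monic_irreducible_dvd hb.ne_zero).preimage hinj.injOn).subset fun k hk => ?_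
      exact ⟨hτm k, hτi k, by_contra fun hd => hk ⟨a, b, hd, rfl⟩⟩
    have h0 : (0 : ℤ) ∈ Z := by simpa [Z, τ] using hpole
    obtain ⟨M, hM, hMmax⟩ := hZ.exists_maximal ⟨0, h0⟩
    obtain ⟨m, hm', hmin⟩ := hZ.exists_minimal ⟨0, h0⟩
    have hmM : m ≤ M := (le_total m M).elim id fun hle => hMmax hm' hle
    have hM1 : IsRegularAt t (τ (M + 1)) g := by
      by_contra hcon
      have := hMmax (y := M + 1) hcon (by omega)
      omega
    have hm1 : IsRegularAt t (τ (m - 1)) g := by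
      by_contra hcon
      have := hmin (y := m - 1) hcon (by omega)
      omega
    -- The last pole `τ M` of `g` moves to `τ (M + 1)` in `σ g`, where `g` has none to cancel it.
    -- Likewise the first pole `τ m` of `g` is not a pole of `σ g`.
    have hp1 : ¬ IsRegularAt t (τ (M + 1)) (σ g - g) := by
      intro hr
      refine hM ((h.isRegularAt_iff).1 ?_)
      rw [hτ]
      -- Subtracting `(g - g) - g` amounts to adding `g`.
      have := hr.sub ht (hτi _).prime ((hM1.sub ht (hτi _).prime hM1).sub ht (hτi _).prime hM1)
      simpa using this
    have hp2 : ¬ IsRegularAt t (τ m) (σ g - g) := by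
      intro hr
      have h1 : IsRegularAt t (τ m) (σ g) := by
        have := (h.isRegularAt_iff).2 hm1
        rwa [hτ, sub_add_cancel] at this
      have := h1.sub ht (hτi _).prime hr
      exact hm' (by simpa using this)
    have h1 := mem_of_not_isRegularAt hS.1 hu (hτm _) (hτi _) hp1
    have h2 := mem_of_not_isRegularAt hS.1 hu (hτm _) (hτi _) hp2
    -- Both poles belong to `S` and to one class, which forces `M + 1 = m` against `m ≤ M`.
    have := hinj ((aeval_inj ht).1 (eq_of_mem_representatives h hS hm hq h1 h2))
    omega
  obtain ⟨a, b, hb, hab, hdeg, rfl⟩ := hg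
  have hb1 := hb.eq_one_of_isUnit (isUnit_of_isRegularAt ht hb.ne_zero hab hreg)
  subst hb1
  rw [degree_one, Nat.WithBot.lt_zero_iff, degree_eq_bot] at hdeg
  simp [hdeg]

end Proper

/-! ### Reduction of polynomials modulo differences. -/

section Polynomials

variable {L : Type*} [Field L] [CharZero L] (s : RingAut L) (β : L) (W : AddSubgroup L)

theorem exists_polynomial_reduction
    (hW : ∀ a : L, ∃ w ∈ W, ∃ b c : L, s c = c ∧ a = w + (s b - b) + c * β) (p : L[X]) :
    ∃ g v : L[X], (∀ k, v.coeff k ∈ W) ∧ p = twist s β g - g + v := by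
  obtain ⟨d, hd⟩ : ∃ d : ℕ, p.degree < d := ⟨p.natDegree + 1,
    degree_le_natDegree.trans_lt (by exact_mod_cast Nat.lt_succ_self _)⟩
  induction d generalizing p with
  | zero =>
    have : p = 0 := by simpa [Nat.WithBot.lt_zero_iff] using hd
    exact ⟨0, 0, by simp [W.zero_mem], by simp [this]⟩
  | succ d ih =>
    obtain ⟨w, hw, b, c, hc, ha⟩ := hW (p.coeff d)
    have hd1 : ((d : L) + 1) ≠ 0 := by exact_mod_cast d.succ_ne_zero
    -- In degree `d` the difference of this `g` has coefficient `(s b - b) + c * β`. In degree `d +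
    -- 1` it vanishes because `c` is constant. Thus only `w` is left of the top coefficient of `p`.
    set g : L[X] := monomial (d + 1) (c / (d + 1)) + monomial d b with hg
    have hgdeg : g.natDegree ≤ d + 1 :=
      natDegree_add_le_of_degree_le (natDegree_monomial_le _)
        ((natDegree_monomial_le _).trans d.le_succ)
    have hlow : (p - (twist s β g - g) - monomial d w).degree < d := by
      rw [degree_lt_iff_coeff_zero]
      intro n hn
      rw [coeff_sub, coeff_sub, coeff_sub]
      rcases hn.eq_or_lt with rfl | hn
      · rw [coeff_twist s β hgdeg, ha]
        simp only [hg, coeff_add, coeff_monomial]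
        simp [hc]
        field_simp
        ring
      · rw [coeff_eq_zero_of_degree_lt (hd.trans_le (by exact_mod_cast hn)),
          coeff_twist_of_natDegree_le s β (hgdeg.trans hn)]
        simp only [hg, coeff_add, coeff_monomial]
        rw [if_neg hn.ne, if_neg hn.ne]
        split_ifs <;> simp [hc]
    obtain ⟨g', v, hv, he⟩ := ih _ hlow
    refine ⟨g + g', v + monomial d w, fun k => ?_, ?_⟩
    · rw [coeff_add, coeff_monomial]
      split_ifs
      · exact add_mem (hv k) hw
      · exact add_mem (hv k) W.zero_mem
    · rw [map_add]
      linear_combination he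

/-- The top coefficient of the difference is `Δ` of the leading coefficient of `g`, so it vanishes
and that leading coefficient is constant. In positive degree the next coefficient has the form `s b
- b + c * β` with `c` a nonzero multiple of it, contradicting `hW`. -/
theorem eq_zero_of_coeff_twist_sub_mem
    (hW : ∀ w ∈ W, ∀ b c : L, s c = c → w = s b - b + c * β → c = 0 ∧ w = 0) {g : L[X]}
    (hg : ∀ k, (twist s β g - g).coeff k ∈ W) : twist s β g - g = 0 := by
  have htop := hW _ (hg g.natDegree) (g.coeff g.natDegree) 0 (map_zero s)
    (by rw [coeff_sub, coeff_twist_of_natDegree_le s β le_rfl]; ring)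
  have hconst : s (g.coeff g.natDegree) = g.coeff g.natDegree := by
    have := htop.2
    rwa [coeff_sub, coeff_twist_of_natDegree_le s β le_rfl, sub_eq_zero] at this
  cases hd : g.natDegree with
  | zero =>
    rw [hd] at htop
    rw [eq_C_of_natDegree_le_zero (p := twist s β g - g), htop.2, C_0]
    refine (natDegree_sub_le _ _).trans ?_
    rw [natDegree_twist, hd, max_self]
  | succ n =>
    exfalso
    rw [hd] at hconst
    have h := hW _ (hg n) (g.coeff n) ((n + 1) * g.coeff (n + 1)) (by simp [hconst]) (by
      rw [coeff_sub, coeff_twist s β hd.le, hconst]; ring)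
    have hn : ((n : L) + 1) ≠ 0 := by exact_mod_cast n.succ_ne_zero
    have h0 : g.coeff (n + 1) = 0 := (mul_eq_zero.1 h.1).resolve_left hn
    have hg0 : g ≠ 0 := by rintro rfl; simp at hd
    rw [← hd] at h0
    exact leadingCoeff_ne_zero.2 hg0 h0

end Polynomials

/-! ### The decomposition `L(t) = Δ(L(t)) ⊕ U_S ⊕ V_θ`. -/

section Step

variable {F₀ : Type u} {K : Type v} [Field F₀] [Field K] [Algebra F₀ K]
  {L : IntermediateField F₀ K} {t : K} {σ : RingAut K} {s : RingAut L} {β : L}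
  {C : Type w} [Field C] [Algebra C F₀] [Algebra C K] [IsScalarTower C F₀ K]

/-- The coefficient space `im φ ∩ ker θ^*`. -/
def reducedKernel (φ : L →ₗ[C] L) (B : Set K) (θ : K) : Submodule C L where
  carrier := {a | a ∈ LinearMap.range φ ∧ HasCoord C B θ (a : K) 0}
  zero_mem' := ⟨zero_mem _, HasCoord.zero⟩
  add_mem' := fun ha hb => ⟨add_mem ha.1 hb.1, by simpa using ha.2.add hb.2⟩
  smul_mem' := fun c a ha => ⟨Submodule.smul_mem _ _ ha.1, by simpa using ha.2.smul c⟩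

theorem mem_summableIn_iff (hs : ∀ c : L, σ c = s c) {f : L} :
    f ∈ summableIn σ L ↔ ∃ b : L, f = s b - b := by
  constructor
  · rintro ⟨b, hb⟩
    exact ⟨b, Subtype.ext (by rw [hb, hs]; rfl)⟩
  · rintro ⟨b, rfl⟩
    exact ⟨b, by rw [hs]; rfl⟩

theorem coe_algebraMap (c : C) : ((algebraMap C L c : L) : K) = algebraMap C K c := rfl

/-- Every element of `L` splits along `Δ(L)`, `C β` and the coefficient space. -/
theorem exists_split_of_effective (hs : ∀ c : L, σ c = s c)
    (hC : ∀ c : C, σ (algebraMap C K c) = algebraMap C K c) {φ : L →ₗ[C] L}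
    (hφ : IsCompleteReduction (summableIn σ L) φ) {B : Set K}
    (hspan : ∀ f : L, (f : K) ∈ Submodule.span C B) {θ : K} {e : C} (he : e ≠ 0)
    (hθ : HasCoord C B θ (φ β : K) e) (a : L) :
    ∃ w ∈ (reducedKernel φ B θ).toAddSubgroup, ∃ b c : L, s c = c ∧
      a = w + (s b - b) + c * β := by
  obtain ⟨x, hx⟩ := exists_hasCoord θ (hspan (φ a))
  obtain ⟨b₁, hb₁⟩ := (mem_summableIn_iff hs).1 (hφ.1 a)
  obtain ⟨b₂, hb₂⟩ := (mem_summableIn_iff hs).1 (hφ.1 β)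
  have hsc : ∀ c : C, s (algebraMap C L c) = algebraMap C L c := fun c =>
    Subtype.ext (by rw [← hs, coe_algebraMap, hC])
  -- The multiple of `φ β` is chosen to cancel the `θ`-coordinate `x` of `φ a`. Replacing `φ β` by
  -- `β` costs the difference of `b₂`.
  refine ⟨φ a - (x / e) • φ β, ⟨⟨a - (x / e) • β, by simp⟩, ?_⟩,
    b₁ - algebraMap C L (x / e) * b₂, algebraMap C L (x / e), hsc _, ?_⟩
  · have := hx.add (hθ.smul (-(x / e)))
    have h0 : x + -(x / e) * e = 0 := by field_simp; ring
    rw [h0] at this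
    convert this using 1
    simp [sub_eq_add_neg]
  · rw [map_sub, map_mul, hsc, Algebra.smul_def]
    linear_combination hb₁ - algebraMap C L (x / e) * hb₂

theorem eq_zero_of_mem_reducedKernel (hs : ∀ c : L, σ c = s c)
    (hc : ∀ f : K, σ f = f → ∃ c : C, algebraMap C K c = f) {φ : L →ₗ[C] L}
    (hφ : IsCompleteReduction (summableIn σ L) φ) {B : Set K} (hB : LinearIndepOn C id B)
    {θ : K} {e : C} (he : e ≠ 0) (hθ : HasCoord C B θ (φ β : K) e) {w : L}
    (hw : w ∈ (reducedKernel φ B θ).toAddSubgroup) {b c : L} (hcc : s c = c)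
    (h : w = s b - b + c * β) : c = 0 ∧ w = 0 := by
  obtain ⟨x, hx⟩ := hc c (by rw [hs, hcc])
  obtain rfl : algebraMap C L x = c := Subtype.ext hx
  -- `φ` fixes `w` and kills `s b - b`. Comparing `θ`-coordinates then gives `0 = x * e`.
  have hw1 : w = x • φ β := by
    have h1 := congrArg φ h
    rwa [hφ.apply_of_mem_range hw.1, map_add, hφ.apply_eq_zero_iff.2
      ((mem_summableIn_iff hs).2 ⟨b, rfl⟩), zero_add, ← Algebra.smul_def, map_smul] at h1
  have h2 : HasCoord C B θ (w : K) (x * e) := by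
    rw [hw1]; exact hθ.smul x
  have h3 := (mul_eq_zero.1 (h2.unique hB hw.2)).resolve_right he
  rw [hw1, h3]
  simp

theorem mem_polyComplement_iff {φ : L →ₗ[C] L} {B : Set K} {θ f : K} :
    f ∈ polyComplement L t φ B θ ↔
      ∃ p : L[X], (∀ k, p.coeff k ∈ (reducedKernel φ B θ).toAddSubgroup) ∧ f = aeval t p :=
  Iff.rfl

/-- The space `U_S` as a subspace. -/
def properComplementSubmodule (C : Type w) [Field C] [Algebra C F₀] [Algebra C K]
    [IsScalarTower C F₀ K] (ht : Transcendental L t) {S : Set K}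
    (hS : S ⊆ monicIrreducibles L t) : Submodule C K where
  carrier := properComplement L t S
  zero_mem' := ⟨zero_mem_properFractions, 0, 1, one_mem _, by simp⟩
  add_mem' := by
    rintro _ _ ⟨hf, a, d, hd, rfl⟩ ⟨hg, b, e, he, rfl⟩
    refine ⟨add_mem_properFractions ht hf hg, ?_⟩
    obtain ⟨D, hD, rfl, -⟩ := exists_of_mem_closure hS hd
    obtain ⟨E, hE, rfl, -⟩ := exists_of_mem_closure hS he
    refine ⟨a * E + D * b, _, mul_mem hd he, ?_⟩
    rw [div_add_div _ _ (aeval_ne_zero ht hD.ne_zero) (aeval_ne_zero ht hE.ne_zero)]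
    simp
  smul_mem' := by
    rintro c _ ⟨hf, a, d, hd, rfl⟩
    rw [Algebra.smul_def]
    refine ⟨mul_mem_properFractions ht (algebraMap C L c) hf, Polynomial.C (algebraMap C L c) * a, d, hd, ?_⟩
    rw [map_mul, aeval_C, mul_div_assoc]
    rfl

/-- The space `V_θ` as a subspace. -/
def polyComplementSubmodule (t : K) (φ : L →ₗ[C] L) (B : Set K) (θ : K) : Submodule C K where
  carrier := polyComplement L t φ B θ
  zero_mem' := mem_polyComplement_iff.2 ⟨0, fun k => by simp, by simp⟩
  add_mem' := by
    rintro _ _ ⟨p, hp, rfl⟩ ⟨q, hq, rfl⟩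
    refine mem_polyComplement_iff.2 ⟨p + q, fun k => ?_, by simp⟩
    rw [coeff_add]
    exact add_mem (hp k) (hq k)
  smul_mem' := by
    rintro c _ ⟨p, hp, rfl⟩
    refine mem_polyComplement_iff.2 ⟨Polynomial.C (algebraMap C L c) * p, fun k => ?_, ?_⟩
    · rw [coeff_C_mul, ← Algebra.smul_def]
      exact (reducedKernel φ B θ).smul_mem c (hp k)
    · rw [map_mul, aeval_C, Algebra.smul_def]
      rfl

theorem div_mem_properComplement (ht : Transcendental L t) (h : IsShift s β σ t) {S : Set K}
    {p : K} (hp : p ∈ S) {q : L[X]} {ℓ : ℤ} {c : L} (hc : c ≠ 0)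
    (hpq : p = c * (σ ^ ℓ) (aeval t q)) {a : L[X]} {j : ℕ} (hq : q.Monic)
    (hdeg : a.degree < (q ^ j).degree) :
    (σ ^ ℓ) (aeval t a / aeval t q ^ j) ∈ properComplement L t S := by
  have hc' : (c : K) ≠ 0 := by simpa using hc
  constructor
  · rw [← map_pow, map_div₀, h.zpow_aeval, h.zpow_aeval]
    refine div_mem_properFractions ht ?_
    rwa [degree_zpow_twist, degree_zpow_twist]
  · refine ⟨Polynomial.C (c ^ j) * (twist s β ^ ℓ) a, p ^ j, pow_mem (Submonoid.subset_closure hp) j, ?_⟩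
    have h1 : aeval t ((twist s β ^ ℓ) q) ≠ 0 := aeval_ne_zero ht (monic_zpow_twist s β hq ℓ).ne_zero
    rw [hpq, map_div₀, map_pow, h.zpow_aeval, h.zpow_aeval, map_mul, aeval_C, map_pow]
    change _ = (c : K) ^ j * _ / _
    rw [mul_pow, mul_div_mul_left _ _ (pow_ne_zero j hc')]

/-- Telescoping: replacing a fraction by a `σ`-shift of it changes it only by differences. -/
theorem sub_zpow_mem {D : AddSubgroup K} {f : K} {σ : RingAut K}
    (hD : ∀ ℓ : ℤ, σ ((σ ^ ℓ) f) - (σ ^ ℓ) f ∈ D) (ℓ : ℤ) : f - (σ ^ ℓ) f ∈ D := by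
  induction ℓ with
  | zero => simp
  | succ k ih =>
    have := sub_mem ih (hD k)
    rw [add_comm, zpow_one_add, RingAut.mul_apply]
    simpa using this
  | pred k ih =>
    have h1 : σ ((σ ^ (-(k : ℤ) - 1)) f) = (σ ^ (-(k : ℤ))) f := by
      rw [← RingAut.mul_apply, ← zpow_one_add, add_sub_cancel]
    have := add_mem ih (hD (-(k : ℤ) - 1))
    rw [h1] at this
    simpa using this

/-- The space `Δ(L')` as a subspace of `K`. -/
def deltaSubmodule (L' : IntermediateField F₀ K)
    (hC : ∀ c : C, σ (algebraMap C K c) = algebraMap C K c) : Submodule C K where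
  carrier := {f | ∃ g ∈ L', f = σ g - g}
  zero_mem' := ⟨0, zero_mem _, by simp⟩
  add_mem' := by
    rintro _ _ ⟨f, hf, rfl⟩ ⟨g, hg, rfl⟩
    exact ⟨f + g, add_mem hf hg, by rw [map_add]; ring⟩
  smul_mem' := by
    rintro c _ ⟨g, hg, rfl⟩
    refine ⟨algebraMap C K c * g, mul_mem ?_ hg, ?_⟩
    · rw [IsScalarTower.algebraMap_apply C F₀ K]
      exact L'.algebraMap_mem _
    · rw [Algebra.smul_def, map_mul, hC, mul_sub]

theorem properFractions_subset {L' : IntermediateField F₀ K}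
    (hL' : ∀ f : K, f ∈ L' ↔ ∃ a b : L[X], f = aeval t a / aeval t b) {f : K}
    (hf : f ∈ properFractions L t) : f ∈ L' := by
  obtain ⟨a, b, -, -, -, rfl⟩ := hf
  exact (hL' _).2 ⟨a, b, rfl⟩

theorem aeval_mem_of_forall_iff {L' : IntermediateField F₀ K}
    (hL' : ∀ f : K, f ∈ L' ↔ ∃ a b : L[X], f = aeval t a / aeval t b) (p : L[X]) :
    aeval t p ∈ L' :=
  (hL' _).2 ⟨p, 1, by simp⟩

theorem IsShift.zpow_mem (h : IsShift s β σ t) {L' : IntermediateField F₀ K}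
    (hL' : ∀ f : K, f ∈ L' ↔ ∃ a b : L[X], f = aeval t a / aeval t b) (ℓ : ℤ) {f : K}
    (hf : f ∈ L') : (σ ^ ℓ) f ∈ L' := by
  obtain ⟨a, b, rfl⟩ := (hL' f).1 hf
  exact (hL' _).2 ⟨_, _, by rw [map_div₀, h.zpow_aeval, h.zpow_aeval]⟩

variable [CharZero L] {L' : IntermediateField F₀ K} {φ : L →ₗ[C] L} {B : Set K} {θ : K} {e : C}
  {S : Set K}

theorem mem_delta_sup_complement (ht : Transcendental L t) (h : IsShift s β σ t)
    (hL' : ∀ f : K, f ∈ L' ↔ ∃ a b : L[X], f = aeval t a / aeval t b)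
    (hC : ∀ c : C, σ (algebraMap C K c) = algebraMap C K c)
    (hφ : IsCompleteReduction (summableIn σ L) φ)
    (hspan : ∀ f : L, (f : K) ∈ Submodule.span C B) (he : e ≠ 0)
    (hθ : HasCoord C B θ (φ β : K) e) (hS : IsRepresentatives σ L t S) {f : K} (hf : f ∈ L') :
    f ∈ deltaSubmodule L' hC ⊔
      (properComplementSubmodule C ht hS.1 ⊔ polyComplementSubmodule t φ B θ) := by
  set D := deltaSubmodule L' hC
  set U := properComplementSubmodule C ht hS.1
  set V := polyComplementSubmodule t φ B θ
  have hpoly : ∀ p : L[X], aeval t p ∈ D ⊔ (U ⊔ V) := by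
    intro p
    obtain ⟨g, v, hv, hp⟩ := exists_polynomial_reduction s β (reducedKernel φ B θ).toAddSubgroup
      (exists_split_of_effective h.base hC hφ hspan he hθ) p
    rw [hp, map_add, map_sub, ← h.map_aeval]
    exact add_mem
      (Submodule.mem_sup_left ⟨aeval t g, aeval_mem_of_forall_iff hL' g, rfl⟩)
      (Submodule.mem_sup_right (Submodule.mem_sup_right (mem_polyComplement_iff.2 ⟨v, hv, rfl⟩)))
  obtain ⟨a, b, rfl⟩ := (hL' f).1 hf
  -- The target is only a `C`-subspace, so an induction over the `L`-span must carry an arbitrary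
  -- factor from `L`.
  have hall : ∀ x ∈ Submodule.span L (canonicalStep L t), ∀ c : L, (c : K) * x ∈ D ⊔ (U ⊔ V) := by
    intro x hx
    induction hx using Submodule.span_induction with
    | zero => simp
    | add x y _ _ hx hy =>
      intro c
      rw [mul_add]
      exact add_mem (hx c) (hy c)
    | smul r x _ hx =>
      intro c
      have : (c : K) * r • x = ((c * r : L) : K) * x := by
        rw [Algebra.smul_def]
        exact (mul_assoc _ _ _).symm
      rw [this]
      exact hx _
    | mem x hx =>
      intro c
      rcases hx with ⟨k, rfl⟩ | ⟨q, hm, hq, k, j, hk, hj, rfl⟩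
      · have : (c : K) * t ^ k = aeval t (monomial k c) := by rw [aeval_monomial]; rfl
        rw [this]
        exact hpoly _
      · have : (c : K) * (t ^ k / aeval t q ^ j) = aeval t (monomial k c) / aeval t q ^ j := by
          rw [aeval_monomial, ← mul_div_assoc]; rfl
        rw [this]
        obtain ⟨p, ⟨hp, d, hd, ℓ, hpq⟩, -⟩ := hS.2 _ ⟨q, hm, hq, rfl⟩
        set x := aeval t (monomial k c) / aeval t q ^ j with hx
        have hxL : x ∈ L' := (hL' _).2 ⟨_, _, by rw [hx, ← map_pow]⟩
        have h1 : x - (σ ^ ℓ) x ∈ D := by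
          refine sub_zpow_mem (D := D.toAddSubgroup) (fun ℓ => ?_) ℓ
          exact ⟨_, h.zpow_mem hL' ℓ hxL, rfl⟩
        have h2 : (σ ^ ℓ) x ∈ U := by
          refine div_mem_properComplement ht h hp hd hpq hm ?_
          refine (degree_monomial_le _ _).trans_lt ?_
          rw [degree_eq_natDegree (hm.pow j).ne_zero, hm.natDegree_pow]
          have : k < j * q.natDegree := hk.trans_le (Nat.le_mul_of_pos_left _ hj)
          exact_mod_cast this
        have : _ ∈ D ⊔ (U ⊔ V) := add_mem (Submodule.mem_sup_left h1)
          (Submodule.mem_sup_right (Submodule.mem_sup_left h2))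
        simpa using this
  simpa using hall _ (div_mem_span_canonicalStep ht a b) 1

theorem disjoint_delta_complement (ht : Transcendental L t) (h : IsShift s β σ t)
    (hL' : ∀ f : K, f ∈ L' ↔ ∃ a b : L[X], f = aeval t a / aeval t b)
    (hC : ∀ c : C, σ (algebraMap C K c) = algebraMap C K c)
    (hc : ∀ f : K, σ f = f → ∃ c : C, algebraMap C K c = f)
    (hφ : IsCompleteReduction (summableIn σ L) φ) (hB : LinearIndepOn C id B) (he : e ≠ 0)
    (hθ : HasCoord C B θ (φ β : K) e) (hS : IsRepresentatives σ L t S) :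
    Disjoint (deltaSubmodule L' hC)
      (properComplementSubmodule C ht hS.1 ⊔ polyComplementSubmodule t φ B θ) := by
  rw [Submodule.disjoint_def]
  rintro _ ⟨g, hg, rfl⟩ hW
  obtain ⟨x, hx, y, hy, hxy⟩ := Submodule.mem_sup.1 hW
  obtain ⟨v, hv, rfl⟩ := mem_polyComplement_iff.1 hy
  obtain ⟨a, b, rfl⟩ := (hL' g).1 hg
  obtain ⟨p, r, hr, hg'⟩ := exists_aeval_add_proper ht a b
  rw [hg'] at hxy ⊢
  have hx' : x ∈ properComplement L t S := hx
  -- This proper fraction equals a polynomial by `hxy`, so both are zero and the two parts can be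
  -- treated separately.
  have hdiff : σ r - r - x ∈ properFractions L t :=
    sub_mem_properFractions ht (sub_mem_properFractions ht (h.map_mem_properFractions ht hr) hr)
      hx'.1
  have hpv : aeval t (v - (twist s β p - p)) = σ r - r - x := by
    rw [map_add, h.map_aeval] at hxy
    rw [map_sub, map_sub]
    linear_combination hxy
  have hv0 : v - (twist s β p - p) = 0 :=
    eq_zero_of_aeval_mem_properFractions ht (hpv ▸ hdiff)
  rw [hv0, map_zero] at hpv
  have hr0 : r = 0 := by
    refine eq_zero_of_delta_mem_properComplement ht h (fun f hf => ?_) hS hr ?_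
    · obtain ⟨c, rfl⟩ := hc f hf
      exact ⟨algebraMap C L c, rfl⟩
    · rwa [sub_eq_zero.1 hpv.symm]
  have hp0 : twist s β p - p = 0 :=
    eq_zero_of_coeff_twist_sub_mem s β (reducedKernel φ B θ).toAddSubgroup
      (fun w hw b c hcc hwb => eq_zero_of_mem_reducedKernel h.base hc hφ hB he hθ hw hcc hwb)
      (fun k => by rw [← sub_eq_zero.1 hv0]; exact hv k)
  rw [hr0, add_zero, h.map_aeval, ← map_sub, hp0, map_zero]

/-- The complete reduction for `Δ(L(t))` along `U_S ⊕ V_θ`. -/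
theorem exists_isCompleteReduction_step (ht : Transcendental L t) (h : IsShift s β σ t)
    (hL' : ∀ f : K, f ∈ L' ↔ ∃ a b : L[X], f = aeval t a / aeval t b)
    (hC : ∀ c : C, σ (algebraMap C K c) = algebraMap C K c)
    (hc : ∀ f : K, σ f = f → ∃ c : C, algebraMap C K c = f)
    (hφ : IsCompleteReduction (summableIn σ L) φ) (hB : LinearIndepOn C id B)
    (hspan : ∀ f : L, (f : K) ∈ Submodule.span C B) (he : e ≠ 0)
    (hθ : HasCoord C B θ (φ β : K) e) (hS : IsRepresentatives σ L t S) :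
    ∃ φ' : L' →ₗ[C] L', IsCompleteReduction (summableIn σ L') φ' ∧
      {x : K | ∃ y ∈ LinearMap.range φ', (y : K) = x} =
        Set.image2 (· + ·) (properComplement L t S) (polyComplement L t φ B θ) := by
  set D := deltaSubmodule L' hC with hD
  set W := properComplementSubmodule C ht hS.1 ⊔ polyComplementSubmodule t φ B θ with hW
  have hWL : ∀ x ∈ W, x ∈ L' := by
    intro x hx
    obtain ⟨u, hu, v, hv, rfl⟩ := Submodule.mem_sup.1 hx
    obtain ⟨p, -, rfl⟩ := mem_polyComplement_iff.1 hv
    exact add_mem (properFractions_subset hL' hu.1) (aeval_mem_of_forall_iff hL' p)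
  have hdisj := disjoint_delta_complement ht h hL' hC hc hφ hB he hθ hS
  let i : L' →ₗ[C] K :=
    { toFun := fun x => x, map_add' := fun _ _ => rfl, map_smul' := fun _ _ => rfl }
  have hDset : ((D.comap i : Submodule C L') : Set L') = summableIn σ L' := by
    ext f
    constructor
    · rintro ⟨g, hg, hf⟩
      exact ⟨⟨g, hg⟩, hf⟩
    · rintro ⟨g, hf⟩
      exact ⟨g, g.2, hf⟩
  have hcompl : IsCompl (D.comap i) (W.comap i) := by
    constructor
    · rw [Submodule.disjoint_def]
      intro x hx hx'
      exact Subtype.ext (Submodule.disjoint_def.1 hdisj _ hx hx')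
    · rw [codisjoint_iff, eq_top_iff]
      intro z _
      obtain ⟨d, hd, w, hw, hdw⟩ := Submodule.mem_sup.1
        (mem_delta_sup_complement ht h hL' hC hφ hspan he hθ hS z.2)
      have hdL : d ∈ L' := by
        rw [← eq_sub_iff_add_eq] at hdw
        rw [hdw]
        exact sub_mem z.2 (hWL w hw)
      exact Submodule.mem_sup.2 ⟨⟨d, hdL⟩, hd, ⟨w, hWL w hw⟩, hw, Subtype.ext hdw⟩
  obtain ⟨φ', h1, h2⟩ := exists_isCompleteReduction hcompl
  refine ⟨φ', hDset ▸ h1, ?_⟩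
  rw [h2]
  ext x
  constructor
  · rintro ⟨y, hy, rfl⟩
    obtain ⟨u, hu, v, hv, huv⟩ := Submodule.mem_sup.1 (show i y ∈ W from hy)
    exact ⟨u, hu, v, hv, huv⟩
  · rintro ⟨u, hu, v, hv, rfl⟩
    have huv : u + v ∈ W := Submodule.mem_sup.2 ⟨u, hu, v, hv, rfl⟩
    exact ⟨⟨u + v, hWL _ huv⟩, huv, rfl⟩

end Step

/-! ### Existence of representatives; restriction of `σ` to a subfield. -/

section Representatives

variable {F₀ : Type u} {K : Type v} [Field F₀] [Field K] [Algebra F₀ K]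
  {L : IntermediateField F₀ K} {σ : RingAut K} {s : RingAut L}

theorem coe_zpow_apply (hs : ∀ c : L, σ c = s c) (c : L) (ℓ : ℤ) :
    (σ ^ ℓ) (c : K) = ((s ^ ℓ) c : L) := by
  induction ℓ with
  | zero => rfl
  | succ k ih =>
    rw [add_comm, zpow_one_add, RingAut.mul_apply, ih, hs, zpow_one_add, RingAut.mul_apply]
  | pred k ih =>
    apply σ.injective
    rw [hs, ← RingAut.mul_apply, ← RingAut.mul_apply, ← zpow_one_add, ← zpow_one_add]
    rwa [add_sub_cancel]

theorem sigmaEquiv_equivalence (hs : ∀ c : L, σ c = s c) : Equivalence (SigmaEquiv σ L) where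
  refl p := ⟨1, one_ne_zero, 0, by simp⟩
  symm := by
    rintro p q ⟨c, hc, ℓ, rfl⟩
    refine ⟨(s ^ (-ℓ)) c⁻¹, by simpa using hc, -ℓ, ?_⟩
    have hc' : (c : K) ≠ 0 := by simpa using hc
    rw [← coe_zpow_apply hs, map_mul, ← mul_assoc, ← map_mul]
    have h1 : ((c⁻¹ : L) : K) * c = 1 := by
      rw [← IntermediateField.coe_mul, inv_mul_cancel₀ hc, IntermediateField.coe_one]
    rw [h1, map_one, one_mul, ← RingAut.mul_apply, ← zpow_add, neg_add_cancel]
    rfl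
  trans := by
    rintro p q r ⟨c, hc, k, rfl⟩ ⟨d, hd, ℓ, rfl⟩
    refine ⟨c * (s ^ k) d, mul_ne_zero hc (by simpa using hd), k + ℓ, ?_⟩
    rw [map_mul, coe_zpow_apply hs, zpow_add, RingAut.mul_apply, IntermediateField.coe_mul, mul_assoc]

theorem exists_isRepresentatives (hs : ∀ c : L, σ c = s c) (t : K) :
    ∃ S, IsRepresentatives σ L t S := by
  let E : Setoid (monicIrreducibles L t) :=
    (⟨SigmaEquiv σ L, sigmaEquiv_equivalence hs⟩ : Setoid K).comap Subtype.val
  refine ⟨Set.range fun c : Quotient E => (c.out : K), ?_, fun q hq => ?_⟩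
  · rintro _ ⟨c, rfl⟩
    exact c.out.2
  · refine ⟨_, ⟨⟨Quotient.mk E ⟨q, hq⟩, rfl⟩, Quotient.mk_out (s := E) ⟨q, hq⟩⟩, ?_⟩
    rintro _ ⟨⟨c, rfl⟩, hc⟩
    have : c = Quotient.mk E ⟨q, hq⟩ := by
      rw [← Quotient.out_eq c]
      exact Quotient.sound hc
    simp only [this]

theorem exists_restrict (h₁ : ∀ f ∈ L, σ f ∈ L) (h₂ : ∀ f ∈ L, σ.symm f ∈ L) :
    ∃ s : RingAut L, ∀ c : L, σ c = s c :=
  ⟨{ toFun := fun c => ⟨σ c, h₁ c c.2⟩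
     invFun := fun c => ⟨σ.symm c, h₂ c c.2⟩
     left_inv := fun _ => Subtype.ext (σ.symm_apply_apply _)
     right_inv := fun _ => Subtype.ext (σ.apply_symm_apply _)
     map_mul' := fun _ _ => Subtype.ext (map_mul σ _ _)
     map_add' := fun _ _ => Subtype.ext (map_add σ _ _) }, fun _ => rfl⟩

end Representatives

/-! ### Stages of a tower and triangular changes of generators. -/

section Stage

variable {F₀ : Type u} {K : Type v} [Field F₀] [Field K] [Algebra F₀ K] {n : ℕ} {t : Fin n → K}

theorem stage_mono (t : Fin n → K) {i j : ℕ} (hij : i ≤ j) : stage F₀ t i ≤ stage F₀ t j :=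
  IntermediateField.adjoin.mono _ _ _ fun _ ⟨k, hk, hx⟩ => ⟨k, hk.trans_le hij, hx⟩

theorem mem_stage_of_lt (t : Fin n → K) (j : Fin n) {i : ℕ} (h : (j : ℕ) < i) :
    t j ∈ stage F₀ t i :=
  IntermediateField.subset_adjoin _ _ ⟨j, h, rfl⟩

theorem stage_le {t : Fin n → K} {i : ℕ} {E : IntermediateField F₀ K}
    (h : ∀ j : Fin n, (j : ℕ) < i → t j ∈ E) : stage F₀ t i ≤ E := by
  refine IntermediateField.adjoin_le_iff.2 ?_
  rintro _ ⟨j, hj, rfl⟩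
  exact h j hj

theorem stage_zero (t : Fin n → K) : stage F₀ t 0 = ⊥ :=
  le_bot_iff.1 (stage_le fun _ h => absurd h (Nat.not_lt_zero _))

theorem mem_stage_succ_iff (t : Fin n → K) (i : Fin n) (f : K) :
    f ∈ stage F₀ t (i + 1) ↔ ∃ a b : (stage F₀ t i)[X], f = aeval (t i) a / aeval (t i) b := by
  rw [← IntermediateField.mem_adjoin_simple_iff]
  have : stage F₀ t (i + 1) =
      (IntermediateField.adjoin (stage F₀ t i) {t i}).restrictScalars F₀ := by
    rw [stage, stage, IntermediateField.adjoin_adjoin_left]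
    congr 1
    ext x
    simp only [Set.mem_ofPred_eq, Set.mem_union, Set.mem_singleton_iff]
    constructor
    · rintro ⟨j, hj, rfl⟩
      rcases (Nat.lt_succ_iff.1 hj).eq_or_lt with h | h
      · exact Or.inr (by rw [Fin.ext h])
      · exact Or.inl ⟨j, h, rfl⟩
    · rintro (⟨j, hj, rfl⟩ | rfl)
      · exact ⟨j, by omega, rfl⟩
      · exact ⟨i, by omega, rfl⟩
  rw [this, IntermediateField.mem_restrictScalars]

/-- The change is triangular, hence invertible: once the earlier stages agree, each `t j` is
recovered from `y j`. -/
theorem stage_eq_of_sub_mem {y : Fin n → K} (h : ∀ j : Fin n, y j - t j ∈ stage F₀ t j) (i : ℕ) :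
    stage F₀ y i = stage F₀ t i := by
  have h1 : ∀ i, stage F₀ y i ≤ stage F₀ t i := fun i => stage_le fun j hj => by
    have := add_mem (stage_mono t hj.le (h j)) (mem_stage_of_lt t j hj)
    rwa [sub_add_cancel] at this
  have h2 : ∀ i, stage F₀ t i ≤ stage F₀ y i := by
    intro i
    induction i using Nat.strong_induction_on with
    | _ i ih =>
      refine stage_le fun j hj => ?_
      have := sub_mem (mem_stage_of_lt (F₀ := F₀) y j hj) (stage_mono y hj.le (ih j hj (h j)))
      rwa [sub_sub_cancel] at this
  exact le_antisymm (h1 i) (h2 i)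

variable {σ₀ : RingAut F₀} {σ : RingAut K}

theorem IsSigmaTower.map_mem_stage (ht : IsSigmaTower σ₀ σ t) (i : ℕ) :
    (∀ f ∈ stage F₀ t i, σ f ∈ stage F₀ t i) ∧ ∀ f ∈ stage F₀ t i, σ.symm f ∈ stage F₀ t i := by
  induction i using Nat.strong_induction_on with
  | _ i ih =>
    have hsymm : ∀ x : F₀, σ.symm (algebraMap F₀ K x) = algebraMap F₀ K (σ₀.symm x) := by
      intro x
      rw [RingEquiv.symm_apply_eq, ht.extends_base, RingEquiv.apply_symm_apply]
    constructor
    · intro f hf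
      induction hf using IntermediateField.adjoin_induction with
      | mem x hx =>
        obtain ⟨j, hj, rfl⟩ := hx
        have := add_mem (stage_mono t hj.le (ht.delta_mem j)) (mem_stage_of_lt t j hj)
        rwa [sub_add_cancel] at this
      | algebraMap x => rw [ht.extends_base]; exact IntermediateField.algebraMap_mem _ _
      | add x y _ _ hx hy => rw [map_add]; exact add_mem hx hy
      | inv x _ hx => rw [map_inv₀]; exact inv_mem hx
      | mul x y _ _ hx hy => rw [map_mul]; exact mul_mem hx hy
    · intro f hf
      induction hf using IntermediateField.adjoin_induction with
      | mem x hx =>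
        obtain ⟨j, hj, rfl⟩ := hx
        -- `σ⁻¹ t = t - σ⁻¹(Δ t)` with `Δ t` in a strictly smaller stage, which is why stability
        -- under `σ⁻¹` needs the induction.
        have := sub_mem (mem_stage_of_lt t j hj)
          (stage_mono t hj.le ((ih j hj).2 _ (ht.delta_mem j)))
        rwa [map_sub, σ.symm_apply_apply, sub_sub_cancel] at this
      | algebraMap x => rw [hsymm]; exact IntermediateField.algebraMap_mem _ _
      | add x y _ _ hx hy => rw [map_add]; exact add_mem hx hy
      | inv x _ hx => rw [map_inv₀]; exact inv_mem hx
      | mul x y _ _ hx hy => rw [map_mul]; exact mul_mem hx hy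

theorem IsSigmaTower.exists_restrict (ht : IsSigmaTower σ₀ σ t) (i : ℕ) :
    ∃ s : RingAut (stage F₀ t i), ∀ c : stage F₀ t i, σ c = s c :=
  SigmaTower.exists_restrict (ht.map_mem_stage i).1 (ht.map_mem_stage i).2

/-- Changing each generator by an element of the previous stage preserves `Σ*`-towers. -/
theorem IsSigmaTower.of_sub_mem (ht : IsSigmaTower σ₀ σ t) {y : Fin n → K}
    (h : ∀ j : Fin n, y j - t j ∈ stage F₀ t j) : IsSigmaTower σ₀ σ y where
  extends_base := ht.extends_base
  transcendental i := by
    rw [stage_eq_of_sub_mem h]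
    intro hy
    refine ht.transcendental i ?_
    have := hy.sub (isAlgebraic_algebraMap (A := K) (⟨_, h i⟩ : stage F₀ t i))
    change IsAlgebraic _ (y i - (y i - t i)) at this
    rwa [sub_sub_cancel] at this
  delta_mem i := by
    rw [stage_eq_of_sub_mem h]
    have h1 := add_mem (sub_mem ((ht.map_mem_stage i).1 _ (h i)) (h i)) (ht.delta_mem i)
    rw [map_sub] at h1
    convert h1 using 1
    ring
  generates := by rw [stage_eq_of_sub_mem h]; exact ht.generates
  constants_eq := ht.constants_eq

end Stage

/-! ### The canonical basis of each stage over the constants. -/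

section CanonicalBasis

variable {F₀ : Type u} {K : Type v} [Field F₀] [Field K] [Algebra F₀ K]

section Product

variable {L : IntermediateField F₀ K} {t : K} {C : Type w} [Field C] [Algebra C K] {B : Set K}

theorem linearIndepOn_image2_canonicalStep [Algebra C F₀] [IsScalarTower C F₀ K]
    (ht : Transcendental L t) (hBL : B ⊆ L) (hB : LinearIndepOn C id B) :
    LinearIndepOn C id (Set.image2 (· * ·) B (canonicalStep L t)) := by
  have hb : LinearIndependent C fun b : B => (⟨b, hBL b.2⟩ : L) := by
    let i : L →ₗ[C] K :=
      { toFun := fun x => x, map_add' := fun _ _ => rfl, map_smul' := fun _ _ => rfl }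
    exact LinearIndependent.of_comp i hB
  have hsc : IsScalarTower C L K := IsScalarTower.of_algebraMap_eq fun _ => rfl
  have h := (linearIndependent_smul hb (linearIndependent_canonicalFamily ht)).linearIndepOn_id
  convert h using 1
  rw [← range_canonicalFamily]
  ext x
  constructor
  · rintro ⟨b, hb, _, ⟨k, rfl⟩, rfl⟩
    exact ⟨(⟨b, hb⟩, k), rfl⟩
  · rintro ⟨⟨b, k⟩, rfl⟩
    exact ⟨b, b.2, _, ⟨k, rfl⟩, rfl⟩

theorem mem_span_image2_canonicalStep (ht : Transcendental L t)
    (hspan : ∀ f ∈ L, f ∈ Submodule.span C B) (a b : L[X]) :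
    aeval t a / aeval t b ∈ Submodule.span C (Set.image2 (· * ·) B (canonicalStep L t)) := by
  have hall : ∀ x ∈ Submodule.span L (canonicalStep L t), ∀ c : L,
      (c : K) * x ∈ Submodule.span C (Set.image2 (· * ·) B (canonicalStep L t)) := by
    intro x hx
    induction hx using Submodule.span_induction with
    | zero => simp
    | add x y _ _ hx hy =>
      intro c
      rw [mul_add]
      exact add_mem (hx c) (hy c)
    | smul r x _ hx =>
      intro c
      have : (c : K) * r • x = ((c * r : L) : K) * x := by
        rw [Algebra.smul_def]
        exact (mul_assoc _ _ _).symm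
      rw [this]
      exact hx _
    | mem x hx =>
      rintro ⟨c, hc⟩
      change c * x ∈ _
      have hc' := hspan c hc
      clear hc
      induction hc' using Submodule.span_induction with
      | zero => simp
      | add y z _ _ hy hz => rw [add_mul]; exact add_mem hy hz
      | smul r y _ hy => rw [smul_mul_assoc]; exact Submodule.smul_mem _ _ hy
      | mem y hy => exact Submodule.subset_span ⟨y, hy, x, hx, rfl⟩
  simpa using hall _ (div_mem_span_canonicalStep ht a b) 1

end Product

variable {n : ℕ} {t : Fin n → K} {Θ₀ : Set F₀}

theorem canonicalBasis_subset_succ (i : ℕ) :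
    canonicalBasis Θ₀ t i ⊆ canonicalBasis Θ₀ t (i + 1) := by
  intro x hx
  rw [canonicalBasis]
  split_ifs with h
  · exact ⟨x, hx, 1, Or.inl ⟨0, by simp⟩, mul_one x⟩
  · exact hx

theorem canonicalBasis_mono {i j : ℕ} (hij : i ≤ j) :
    canonicalBasis Θ₀ t i ⊆ canonicalBasis Θ₀ t j :=
  monotone_nat_of_le_succ (f := canonicalBasis Θ₀ t) canonicalBasis_subset_succ hij

theorem canonicalBasis_subset_stage (i : ℕ) : canonicalBasis Θ₀ t i ⊆ stage F₀ t i := by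
  induction i with
  | zero =>
    rintro _ ⟨x, -, rfl⟩
    exact IntermediateField.algebraMap_mem _ _
  | succ i ih =>
    intro x hx
    rw [canonicalBasis] at hx
    split_ifs at hx with h
    · obtain ⟨b, hb, c, hc, rfl⟩ := hx
      refine mul_mem (stage_mono t i.le_succ (ih hb)) ?_
      refine (mem_stage_succ_iff t ⟨i, h⟩ c).2 ?_
      rcases hc with ⟨k, rfl⟩ | ⟨q, -, -, k, j, -, -, rfl⟩
      · exact ⟨X ^ k, 1, by simp⟩
      · exact ⟨X ^ k, q ^ j, by simp⟩
    · exact stage_mono t i.le_succ (ih hx)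

variable {C : Type w} [Field C] [Algebra C F₀] [Algebra C K] [IsScalarTower C F₀ K]

theorem linearIndepOn_canonicalBasis (hli : LinearIndepOn C id Θ₀)
    (ht : ∀ i : Fin n, Transcendental (stage F₀ t i) (t i)) (i : ℕ) :
    LinearIndepOn C id (canonicalBasis Θ₀ t i) := by
  induction i with
  | zero =>
    rw [canonicalBasis]
    have h := (LinearIndependent.map' hli (IsScalarTower.toAlgHom C F₀ K).toLinearMap
      (LinearMap.ker_eq_bot.2 (algebraMap F₀ K).injective)).linearIndepOn_id
    rw [Set.image_eq_range]
    exact h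
  | succ i ih =>
    rw [canonicalBasis]
    split_ifs with h
    · exact linearIndepOn_image2_canonicalStep (ht ⟨i, h⟩) (canonicalBasis_subset_stage i) ih
    · exact ih

theorem mem_span_canonicalBasis (hspan : ∀ f, f ∈ Submodule.span C Θ₀)
    (ht : ∀ i : Fin n, Transcendental (stage F₀ t i) (t i)) {i : ℕ} (hi : i ≤ n) :
    ∀ f ∈ stage F₀ t i, f ∈ Submodule.span C (canonicalBasis Θ₀ t i) := by
  induction i with
  | zero =>
    intro f hf
    rw [stage_zero, IntermediateField.mem_bot] at hf
    obtain ⟨x, rfl⟩ := hf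
    exact Submodule.apply_mem_span_image_of_mem_span
      (IsScalarTower.toAlgHom C F₀ K).toLinearMap (hspan x)
  | succ i ih =>
    intro f hf
    obtain ⟨a, b, rfl⟩ := (mem_stage_succ_iff t ⟨i, hi⟩ f).1 hf
    rw [canonicalBasis, dif_pos (show i < n from hi)]
    exact mem_span_image2_canonicalStep (ht ⟨i, hi⟩) (ih (Nat.le_of_succ_le hi)) a b

theorem mem_stage_indicator {f : K} {i : ℕ} (hf : f ∈ stage F₀ t i) :
    f ∈ stage F₀ t (indicator F₀ t f) :=
  Nat.sInf_mem (s := {i | f ∈ stage F₀ t i}) ⟨i, hf⟩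

theorem indicator_le {f : K} {i : ℕ} (hf : f ∈ stage F₀ t i) : indicator F₀ t f ≤ i :=
  Nat.sInf_le hf

end CanonicalBasis

/-! ### Effective basis elements and invariance under passing to initial segments. -/

section Effective

variable {F₀ : Type u} {K : Type v} [Field F₀] [Field K] [Algebra F₀ K] {n : ℕ} {t : Fin n → K}
  {Θ₀ : Set F₀} {σ₀ : RingAut F₀}

/-- Expand `r` in the basis of the smallest stage containing it. If every basis element that occurs
came from a lower stage, so would `r`. -/
theorem exists_isEffective (hspan : ∀ f, f ∈ Submodule.span (constants σ₀) Θ₀)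
    (ht : ∀ i : Fin n, Transcendental (stage F₀ t i) (t i)) {i : ℕ} (hi : i ≤ n) {r : K}
    (hr : r ∈ stage F₀ t i) (hr0 : r ≠ 0) : ∃ θ, IsEffective σ₀ Θ₀ t i r θ := by
  set j := indicator F₀ t r with hj
  have hji : j ≤ i := indicator_le hr
  have hmem := mem_span_canonicalBasis (C := constants σ₀) hspan ht (hji.trans hi) r
    (mem_stage_indicator hr)
  rw [← Set.image_id (canonicalBasis Θ₀ t j), Finsupp.mem_span_image_iff_linearCombination] at hmem
  obtain ⟨l, hl, hlr⟩ := hmem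
  have key : ∃ θ ∈ l.support, ∀ k < j, θ ∉ stage F₀ t k := by
    by_contra! hcon
    -- For `j = 0` there is no lower stage, so the expansion would have to be empty and `r = 0`.
    rcases Nat.eq_zero_or_pos j with h0 | hpos
    · refine hr0 ?_
      have : l = 0 := by
        rw [← Finsupp.support_eq_empty, Finset.eq_empty_iff_forall_notMem]
        intro θ hθ
        obtain ⟨k, hk, -⟩ := hcon θ hθ
        omega
      rw [← hlr, this, map_zero]
    · have hmem' : r ∈ stage F₀ t (j - 1) := by
        rw [← hlr, Finsupp.linearCombination_apply]
        refine sum_mem fun θ hθ => ?_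
        obtain ⟨k, hk, hθk⟩ := hcon θ hθ
        change l θ • θ ∈ _
        rw [Algebra.smul_def]
        refine mul_mem ?_ (stage_mono t (Nat.le_sub_one_of_lt hk) hθk)
        exact (stage F₀ t (j - 1)).algebraMap_mem (l θ : F₀)
      have := indicator_le hmem'
      omega
  obtain ⟨θ, hθ, hθk⟩ := key
  have hθB : θ ∈ canonicalBasis Θ₀ t j := hl hθ
  refine ⟨θ, canonicalBasis_mono hji hθB, ⟨l θ, Finsupp.mem_support_iff.1 hθ, l,
    Finsupp.supported_mono (canonicalBasis_mono hji) hl, hlr, rfl⟩, ?_⟩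
  have hθj := canonicalBasis_subset_stage j hθB
  refine le_antisymm (indicator_le hθj) (not_lt.1 fun hlt => ?_)
  exact hθk _ hlt (mem_stage_indicator hθj)

theorem stage_initialSegment (t : Fin n → K) (i : Fin n) {k : ℕ} (hk : k ≤ i + 1) :
    stage F₀ (initialSegment t i) k = stage F₀ t k := by
  refine le_antisymm (stage_le fun j hj => mem_stage_of_lt t _ hj) (stage_le fun j hj => ?_)
  exact mem_stage_of_lt (initialSegment t i) ⟨j, hj.trans_le hk⟩ hj

theorem canonicalBasis_initialSegment (t : Fin n → K) (i : Fin n) {k : ℕ} (hk : k ≤ i + 1) :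
    canonicalBasis Θ₀ (initialSegment t i) k = canonicalBasis Θ₀ t k := by
  induction k with
  | zero => rfl
  | succ k ih =>
    have hk' : k < i + 1 := hk
    rw [canonicalBasis, canonicalBasis, dif_pos hk', dif_pos (hk'.trans_le i.isLt),
      ih hk'.le, stage_initialSegment t i hk'.le]
    rfl

theorem indicator_initialSegment (t : Fin n → K) (i : Fin n) {f : K} (hf : f ∈ stage F₀ t i) :
    indicator F₀ (initialSegment t i) f = indicator F₀ t f := by
  have hi : (i : ℕ) ≤ i + 1 := Nat.le_succ _
  have hf' : f ∈ stage F₀ (initialSegment t i) i := by rwa [stage_initialSegment t i hi]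
  have h1 := indicator_le hf
  have h2 := indicator_le hf'
  apply le_antisymm
  · apply indicator_le
    rw [stage_initialSegment t i (h1.trans hi)]
    exact mem_stage_indicator hf
  · apply indicator_le
    rw [← stage_initialSegment t i (h2.trans hi)]
    exact mem_stage_indicator hf'

theorem isEffective_initialSegment_iff (t : Fin n → K) (i : Fin n) {r θ : K}
    (hr : r ∈ stage F₀ t i) :
    IsEffective σ₀ Θ₀ (initialSegment t i) i r θ ↔ IsEffective σ₀ Θ₀ t i r θ := by
  have hi : (i : ℕ) ≤ i + 1 := Nat.le_succ _
  unfold IsEffective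
  rw [canonicalBasis_initialSegment t i hi, indicator_initialSegment t i hr]
  refine and_congr_right fun hθ => ?_
  rw [indicator_initialSegment t i (canonicalBasis_subset_stage _ hθ)]

end Effective

/-! ### Simultaneous construction of generators and reductions. -/

section Construction

variable {F₀ : Type u} {K : Type v} [Field F₀] [Field K] [Algebra F₀ K] {σ₀ : RingAut F₀}
  {Θ₀ : Set F₀}

/-- The conditions that relate two consecutive complete reductions `φ`, `φ'` in a well generated
tower, where `y` is the tuple of generators up to the stage of `φ'` and `δ` is the difference of
the last one. -/
structure IsReductionStep (sel : Selection.{u, v} σ₀ Θ₀) (σ : RingAut K) {m : ℕ}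
    (y : Fin (m + 1) → K) {L L' : IntermediateField F₀ K} (φ : L →ₗ[constants σ₀] L)
    (φ' : L' →ₗ[constants σ₀] L') (δ : L) : Prop where
  delta_eq : (δ : K) = σ (y (Fin.last m)) - y (Fin.last m)
  delta_mem : δ ∈ LinearMap.range φ
  representatives : IsRepresentatives σ L (y (Fin.last m)) (sel.reps σ y)
  effective : IsEffective σ₀ Θ₀ y m (φ δ) (sel.elt σ y (φ δ))
  complete : IsCompleteReduction (summableIn σ L') φ'
  image_eq : {x : K | ∃ z ∈ LinearMap.range φ', (z : K) = x} =
    Set.image2 (· + ·) (properComplement L (y (Fin.last m)) (sel.reps σ y))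
      (polyComplement L (y (Fin.last m)) φ (canonicalBasis Θ₀ y m) (sel.elt σ y (φ δ)))

theorem algebraMap_constants (c : constants σ₀) :
    algebraMap (constants σ₀) K c = algebraMap F₀ K (c : F₀) := rfl

/-- Over a well generated stage, a generator with reduced difference yields a reduction step. -/
theorem exists_isReductionStep [CharZero F₀] (sel : Selection.{u, v} σ₀ Θ₀) {σ : RingAut K}
    {n : ℕ} {y : Fin n → K} (hy : IsSigmaTower σ₀ σ y)
    (hli : LinearIndepOn (constants σ₀) id Θ₀)
    (hspan : ∀ f, f ∈ Submodule.span (constants σ₀) Θ₀) (i : Fin n)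
    {L L' : IntermediateField F₀ K} (hL : stage F₀ y i = L) (hL' : stage F₀ y (i + 1) = L')
    {φ : L →ₗ[constants σ₀] L} (hφ : IsCompleteReduction (summableIn σ L) φ) {δ : L}
    (hδ : (δ : K) = σ (y i) - y i) (hδφ : δ ∈ LinearMap.range φ) :
    ∃ φ' : L' →ₗ[constants σ₀] L', IsReductionStep sel σ (initialSegment y i) φ φ' δ := by
  subst hL hL'
  have : CharZero (stage F₀ y i) := charZero_of_injective_algebraMap (algebraMap F₀ _).injective
  have htr := hy.transcendental i
  have hii : (i : ℕ) ≤ i + 1 := Nat.le_succ _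
  obtain ⟨s, hs⟩ := hy.exists_restrict i
  have hshift : IsShift s δ σ (y i) := ⟨hs, by
    change σ (y i) = y i + (δ : K)
    rw [hδ]; ring⟩
  have hC : ∀ c : constants σ₀, σ (algebraMap _ K c) = algebraMap _ K c := fun c => by
    rw [algebraMap_constants, hy.extends_base]
    exact congrArg _ c.2
  have hc : ∀ f : K, σ f = f → ∃ c : constants σ₀, algebraMap _ K c = f := fun f hf =>
    let ⟨c, hc, h⟩ := hy.constants_eq f hf
    ⟨⟨c, hc⟩, h⟩
  have hφδ : φ δ = δ := hφ.apply_of_mem_range hδφ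
  -- A zero difference would make the generator a constant, hence an element of `F₀`, against
  -- transcendence.
  have hδ0 : ((φ δ : stage F₀ y i) : K) ≠ 0 := by
    rw [hφδ, hδ]
    intro h0
    obtain ⟨c, hc, h⟩ := hy.constants_eq _ (sub_eq_zero.1 h0)
    refine htr ?_
    rw [← h]
    exact isAlgebraic_algebraMap (A := K) (algebraMap F₀ (stage F₀ y i) c)
  have hrep : IsRepresentatives σ (stage F₀ y i) (y i) (sel.reps σ (initialSegment y i)) := by
    have h := sel.reps_spec σ (initialSegment y i)
    rw [stage_initialSegment y i hii] at h
    exact h (exists_isRepresentatives hs _)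
  have heff : IsEffective σ₀ Θ₀ (initialSegment y i) i (φ δ)
      (sel.elt σ (initialSegment y i) (φ δ)) := by
    refine sel.elt_spec σ (initialSegment y i) _ ?_
    obtain ⟨θ, hθ⟩ := exists_isEffective hspan hy.transcendental i.isLt.le (φ δ).2 hδ0
    exact ⟨θ, (isEffective_initialSegment_iff y i (φ δ).2).2 hθ⟩
  obtain ⟨e, he, hcoord⟩ := heff.2.1
  rw [canonicalBasis_initialSegment y i hii] at hcoord
  obtain ⟨φ', h1, h2⟩ := exists_isCompleteReduction_step (B := canonicalBasis Θ₀ y i) htr hshift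
    (mem_stage_succ_iff y i) hC hc hφ (linearIndepOn_canonicalBasis hli hy.transcendental i)
    (fun f => mem_span_canonicalBasis hspan hy.transcendental i.isLt.le f f.2) he hcoord hrep
  refine ⟨φ', ⟨hδ, hδφ, hrep, heff, h1, ?_⟩⟩
  rw [canonicalBasis_initialSegment y i hii]
  exact h2

/-- The reductions are built on the stages of the original tuple. Taking the stages as a function
`A` with one equation `hA` transports the whole dependent family at once. -/
theorem isWellGenerated_of_isReductionStep {φ₀ : F₀ →ₗ[constants σ₀] F₀}
    {sel : Selection.{u, v} σ₀ Θ₀} {σ : RingAut K} {n : ℕ} {y : Fin n → K}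
    (hy : IsSigmaTower σ₀ σ y) {A : ℕ → IntermediateField F₀ K} (hA : A = stage F₀ y)
    {φ : ∀ i, A i →ₗ[constants σ₀] A i}
    (h0 : ∀ f : F₀, φ 0 (algebraMap F₀ (A 0) f) = algebraMap F₀ (A 0) (φ₀ f))
    (h : ∀ i : Fin n, ∃ δ, IsReductionStep sel σ (initialSegment y i) (φ i) (φ (i + 1)) δ) :
    IsWellGenerated φ₀ sel hy := by
  subst hA
  have hδ : ∀ i : Fin n,
      IsReductionStep sel σ (initialSegment y i) (φ i) (φ (i + 1)) (hy.delta i) := by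
    intro i
    obtain ⟨δ, hδ⟩ := h i
    have : δ = hy.delta i := Subtype.ext hδ.delta_eq
    rwa [← this]
  refine ⟨φ, ⟨h0, fun i => (hδ i).representatives, fun i => ?_, fun i => (hδ i).complete,
    fun i => ?_⟩, fun i => (hδ i).delta_mem⟩
  · exact (isEffective_initialSegment_iff y i (φ i _).2).1 (hδ i).effective
  · have := (hδ i).image_eq
    rwa [canonicalBasis_initialSegment y i (Nat.le_succ _)] at this

theorem exists_base_reduction {φ₀ : F₀ →ₗ[constants σ₀] F₀}
    (hφ₀ : IsCompleteReduction (summable σ₀) φ₀) {σ : RingAut K}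
    (hσ : ∀ x : F₀, σ (algebraMap F₀ K x) = algebraMap F₀ K (σ₀ x)) {L : IntermediateField F₀ K}
    (hL : L = ⊥) : ∃ φ : L →ₗ[constants σ₀] L,
      (∀ f : F₀, φ (algebraMap F₀ L f) = algebraMap F₀ L (φ₀ f)) ∧
        IsCompleteReduction (summableIn σ L) φ := by
  subst hL
  let e : (⊥ : IntermediateField F₀ K) ≃ₗ[constants σ₀] F₀ :=
    (IntermediateField.botEquiv F₀ K).toLinearEquiv.restrictScalars (constants σ₀)
  have he : ∀ f : F₀, e (algebraMap F₀ (⊥ : IntermediateField F₀ K) f) = f :=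
    IntermediateField.botEquiv_def
  have hsymm : ∀ f : F₀, e.symm f = algebraMap F₀ (⊥ : IntermediateField F₀ K) f := fun f => by
    rw [LinearEquiv.symm_apply_eq, he]
  have hsum : ∀ f : F₀, algebraMap F₀ (⊥ : IntermediateField F₀ K) f ∈ summableIn σ ⊥ ↔
      f ∈ summable σ₀ := by
    intro f
    constructor
    · rintro ⟨g, hg⟩
      obtain ⟨g, rfl⟩ := e.symm.surjective g
      rw [hsymm] at hg
      refine ⟨g, (algebraMap F₀ K).injective ?_⟩
      rw [map_sub, ← hσ]
      exact hg
    · rintro ⟨g, rfl⟩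
      refine ⟨algebraMap F₀ _ g, ?_⟩
      change algebraMap F₀ K _ = σ (algebraMap F₀ K g) - algebraMap F₀ K g
      rw [map_sub, hσ]
  refine ⟨e.symm.toLinearMap ∘ₗ φ₀ ∘ₗ e.toLinearMap, fun f => ?_, fun f => ?_, ?_⟩
  · simp [he, hsymm]
  · obtain ⟨f, rfl⟩ := e.symm.surjective f
    have := (hsum (f - φ₀ f)).2 (hφ₀.1 f)
    simpa [hsymm, he] using this
  · ext f
    obtain ⟨f, rfl⟩ := e.symm.surjective f
    rw [hsymm, hsum, ← hφ₀.apply_eq_zero_iff]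
    simp [he]

/-- Induction on the number of corrected generators. The maps live on the stages of `t`, which do
not move while `y` changes; beyond stage `i` nothing is asked of them. -/
theorem exists_partial_reductions [CharZero F₀] {φ₀ : F₀ →ₗ[constants σ₀] F₀}
    (hφ₀ : IsCompleteReduction (summable σ₀) φ₀) (sel : Selection.{u, v} σ₀ Θ₀) {σ : RingAut K}
    {n : ℕ} {t : Fin n → K} (ht : IsSigmaTower σ₀ σ t)
    (hli : LinearIndepOn (constants σ₀) id Θ₀)
    (hspan : ∀ f, f ∈ Submodule.span (constants σ₀) Θ₀) {i : ℕ} (hi : i ≤ n) :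
    ∃ y : Fin n → K, (∀ j : Fin n, y j - t j ∈ stage F₀ t j) ∧
      ∃ φ : ∀ k, stage F₀ t k →ₗ[constants σ₀] stage F₀ t k,
        (∀ f : F₀, φ 0 (algebraMap F₀ _ f) = algebraMap F₀ _ (φ₀ f)) ∧
        IsCompleteReduction (summableIn σ (stage F₀ t i)) (φ i) ∧
        ∀ j : Fin n, (j : ℕ) < i →
          ∃ δ, IsReductionStep sel σ (initialSegment y j) (φ j) (φ (j + 1)) δ := by
  induction i with
  | zero =>
    obtain ⟨φ, h1, h2⟩ := exists_base_reduction hφ₀ ht.extends_base (stage_zero t)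
    refine ⟨t, fun j => by rw [sub_self]; exact zero_mem _, Function.update (fun _ => 0) 0 φ,
      ?_, ?_, fun j hj => absurd hj (Nat.not_lt_zero _)⟩
    · rw [Function.update_self]; exact h1
    · rw [Function.update_self]; exact h2
  | succ i ih =>
    obtain ⟨y, hyt, φ, hbase, hcomp, hstep⟩ := ih (Nat.le_of_succ_le hi)
    let j₀ : Fin n := ⟨i, hi⟩
    have hy := ht.of_sub_mem hyt
    have hst := stage_eq_of_sub_mem hyt
    let d : stage F₀ t i := ⟨σ (y j₀) - y j₀, hst i ▸ hy.delta_mem j₀⟩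
    obtain ⟨g, hg⟩ := hcomp.1 d
    -- Since `d - φ i d` is the difference of `g`, the new generator has difference `φ i d`.
    set y' := Function.update y j₀ (y j₀ - g) with hy'def
    have hy't : ∀ j : Fin n, y' j - t j ∈ stage F₀ t j := by
      intro j
      rcases eq_or_ne j j₀ with rfl | hj
      · rw [hy'def, Function.update_self, sub_right_comm]
        exact sub_mem (hyt j₀) g.2
      · rw [hy'def, Function.update_of_ne hj]
        exact hyt j
    have hy' := ht.of_sub_mem hy't
    have hst' := stage_eq_of_sub_mem hy't
    have hδ : ((φ i d : stage F₀ t i) : K) = σ (y' j₀) - y' j₀ := by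
      rw [hy'def, Function.update_self, map_sub]
      have : ((d - φ i d : stage F₀ t i) : K) = σ (y j₀) - y j₀ - (φ i d : K) := rfl
      rw [this] at hg
      linear_combination -hg
    obtain ⟨φ', hφ'⟩ := exists_isReductionStep sel hy' hli hspan j₀ (hst' i) (hst' (i + 1)) hcomp
      hδ ⟨d, rfl⟩
    refine ⟨y', hy't, Function.update φ (i + 1) φ', ?_, ?_, fun j hj => ?_⟩
    · rw [Function.update_of_ne (Nat.succ_ne_zero i).symm]; exact hbase
    · rw [Function.update_self]; exact hφ'.complete
    · rcases (Nat.lt_succ_iff.1 hj).eq_or_lt with h | h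
      · obtain rfl : j = j₀ := Fin.ext h
        refine ⟨φ i d, ?_⟩
        rw [Function.update_of_ne (Nat.succ_ne_self i).symm, Function.update_self]
        exact hφ'
      · obtain ⟨δ, hδ⟩ := hstep j h
        refine ⟨δ, ?_⟩
        -- For `j < i` the segment ends before the altered entry, so the selected data and the
        -- earlier reduction steps persist.
        have hseg : initialSegment y' j = initialSegment y j := by
          funext k
          refine Function.update_of_ne (fun hk => ?_) _ _
          have := congrArg Fin.val hk
          simp only [Fin.val_castLE, j₀] at this
          omega
        rw [hseg, Function.update_of_ne (by omega), Function.update_of_ne (by omega)]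
        exact hδ

end Construction

end SigmaTower

theorem mainTheorem11 {F₀ : Type u} [Field F₀] [CharZero F₀] (σ₀ : RingAut F₀)
    (φ₀ : F₀ →ₗ[SigmaTower.constants σ₀] F₀)
    (hφ₀ : SigmaTower.IsCompleteReduction (SigmaTower.summable σ₀) φ₀)
    {ι : Type w} (Θ₀ : Module.Basis ι (SigmaTower.constants σ₀) F₀)
    (sel : SigmaTower.Selection.{u, v} σ₀ (Set.range Θ₀))
    {F : Type v} [Field F] [Algebra F₀ F] (σ : RingAut F) (n : ℕ) (t : Fin n → F)
    (ht : SigmaTower.IsSigmaTower σ₀ σ t) :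
    ∃ (K : Type v) (_ : Field K) (_ : Algebra F₀ K) (σK : RingAut K) (y : Fin n → K)
      (hy : SigmaTower.IsSigmaTower σ₀ σK y),
      SigmaTower.IsWellGenerated φ₀ sel hy ∧
      ∃ τ : F ≃ₐ[F₀] K, ∀ x : F, τ (σ x) = σK (τ x) := by
  obtain ⟨y, hyt, φ, hbase, -, hstep⟩ := SigmaTower.exists_partial_reductions hφ₀ sel ht
    Θ₀.linearIndependent.linearIndepOn_id
    (fun f => by rw [Θ₀.span_eq]; exact Submodule.mem_top) le_rfl
  refine ⟨F, inferInstance, inferInstance, σ, y, ht.of_sub_mem hyt, ?_, AlgEquiv.refl,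
    fun _ => rfl⟩
  exact SigmaTower.isWellGenerated_of_isReductionStep (ht.of_sub_mem hyt)
    (funext fun i => (SigmaTower.stage_eq_of_sub_mem hyt i).symm) hbase
    fun i => hstep i i.isLt
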